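/- Theorem (universal cover of $V$). All triangles below are Euclidean equilateral triangles of side $1$, and all lozenges are Euclidean rhombi of side $1$ with angles $\pi/3$ (acute) and $2\pi/3$ (obtuse). Let $S$ be the compact complex with three vertices $0,1,2$, twelve oriented edges $x_k\colon 0\to 1$, $y_k\colon 1\to 2$, $z_k\colon 2\to 0$ $(k\in\{a,b,c,d\})$, four triangles with boundary words $x_ky_kz_k$ $(k\in\{a,b,c,d\})$, and three lozenges $x,y,z$ with boundary words, read from an acute corner, $$x_cx_b^{-1}x_dx_a^{-1},\qquad y_by_c^{-1}y_dy_a^{-1},\qquad z_cz_b^{-1}z_dz_a^{-1}.$$ Let $V$ be the compact complex obtained from $S$ by gluing three further lozenges $x',y',z'$ along the boundary words, read from an acute corner, $$x_c^{-1}x_bx_d^{-1}x_a,\qquad y_b^{-1}y_cy_d^{-1}y_a,\qquad z_b^{-1}z_cz_d^{-1}z_a.$$ Let $G=\langle \sigma_1,\sigma_2,\sigma_3\mid \sigma_1\sigma_3=\sigma_3\sigma_1,\ \sigma_1\sigma_2\sigma_1=\sigma_2\sigma_1\sigma_2,\ \sigma_2\sigma_3\sigma_2=\sigma_3\sigma_2\sigma_3,\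 (\sigma_1\sigma_2\sigma_3)^4=1\rangle$ be the four-strand braid group modulo its center, and let $\delta=\sigma_1\sigma_2\sigma_3$. The Brady complex $X$ is the complex whose vertices are the cosets $[g]=g\langle\delta\rangle$, $g \in G$; whose edges are the elements $g$ of $G$, the edge $g$ going from $[g]$ to $[g\sigma_1]$; whose triangles are indexed by $G/\langle\sigma_1\delta\rangle$, the triangle of $g$ being bounded by the edges $g$, $g\sigma_1\delta$, $g(\sigma_1\delta)^2$, with vertices $[g],[g\sigma_1],[g\sigma_1\sigma_2]$; and whose lozenges are indexed by $G/\langle\delta^2\rangle$, the lozenge of $g$ being bounded by the path $(g\sigma_1\delta^2)(g\sigma_3)^{-1}(g\delta^2)^{-1}(g)$ of edges through its corners $[g\sigma_1]$ (acute), $[g\sigma_1\sigma_3]$ (obtuse), $[g\sigma_3]$ (acute), $[g]$ (obtuse), where $e^{-1}$ denotes an edge traversed backwards. Then the universal cover of $V$ is the Brady complex $X$: the space $X$ is simply connected, and there is a surjective covering map $p\colon X\to V$ which carries every closed vertex, edge, triangle and lozenge of $X$ isometrically (with respect to its Euclidean model) onto a closed cell of $V$ of the same type. -/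

import Mathlib

/-! Two-dimensional complexes built from equilateral triangles and lozenges of side `1`. -/

/-- The combinatorial data of a complex of triangles and lozenges: vertices, edges (each with a
reference orientation from `src` to `tgt`), triangles, and lozenges, with their boundaries.
The pair `(e, true)` is the edge `e` traversed from `src e` to `tgt e`, the pair `(e, false)` is
`e` traversed backwards. Side `i` of a face runs from its corner `i` to its corner `i + 1`
(cyclically). Corners `0` and `2` of a lozenge are the acute ones (angle `π / 3`), corners `1`
and `3` the obtuse ones (angle `2 π / 3`). -/
structure LozengeComplex where
  Vert : Type
  Edge : Type
  Tri : Type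
  Loz : Type
  src : Edge → Vert
  tgt : Edge → Vert
  triSide : Tri → Fin 3 → Edge × Bool
  lozSide : Loz → Fin 4 → Edge × Bool
  /-- each side of a triangle starts where the preceding one ends -/
  tri_closed : ∀ t i,
    (bif (triSide t (i + 1)).2 then src (triSide t (i + 1)).1 else tgt (triSide t (i + 1)).1) =
      (bif (triSide t i).2 then tgt (triSide t i).1 else src (triSide t i).1)
  /-- each side of a lozenge starts where the preceding one ends -/
  loz_closed : ∀ l i,
    (bif (lozSide l (i + 1)).2 then src (lozSide l (i + 1)).1 else tgt (lozSide l (i + 1)).1) =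
      (bif (lozSide l i).2 then tgt (lozSide l i).1 else src (lozSide l i).1)

namespace LozengeComplex

/-- The closed cells of a complex. -/
inductive Cell (K : LozengeComplex) : Type
  | vert (v : K.Vert) : Cell K
  | edge (e : K.Edge) : Cell K
  | tri (t : K.Tri) : Cell K
  | loz (l : K.Loz) : Cell K

/-- The primitive sixth root of unity `exp (i π / 3)`. -/
noncomputable def omega : ℂ := ⟨1 / 2, √3 / 2⟩

/-- The corners of the model equilateral triangle. -/
noncomputable def triCorner : Fin 3 → ℂ := ![0, 1, omega]

/-- The corners of the model lozenge. -/
noncomputable def lozCorner : Fin 4 → ℂ := ![0, 1, 1 + omega, omega]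

variable {K : LozengeComplex}

/-- The model of a closed cell, a convex subset of the Euclidean plane `ℂ`: a point, a segment of
length `1`, an equilateral triangle of side `1`, or a lozenge of side `1`. -/
noncomputable def Cell.shape : K.Cell → Set ℂ
  | .vert _ => {0}
  | .edge _ => segment ℝ 0 1
  | .tri _ => convexHull ℝ (Set.range triCorner)
  | .loz _ => convexHull ℝ (Set.range lozCorner)

variable (K)

/-- The disjoint union of the models of all closed cells, with the disjoint union topology. -/
abbrev PreRealization : Type := Σ c : K.Cell, c.shape

/-- The gluing: the two ends of each edge are glued to its two vertices, and each side of each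
face is glued isometrically to the corresponding edge, in the direction of travel. -/
inductive Glue : K.PreRealization → K.PreRealization → Prop
  | src (e : K.Edge) (x : (Cell.edge e : K.Cell).shape) (y : (Cell.vert (K.src e)).shape)
      (hx : (x : ℂ) = 0) : Glue ⟨.edge e, x⟩ ⟨.vert (K.src e), y⟩
  | tgt (e : K.Edge) (x : (Cell.edge e : K.Cell).shape) (y : (Cell.vert (K.tgt e)).shape)
      (hx : (x : ℂ) = 1) : Glue ⟨.edge e, x⟩ ⟨.vert (K.tgt e), y⟩
  | tri (t : K.Tri) (i : Fin 3) (s : ℝ) (x : (Cell.tri t : K.Cell).shape)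
      (y : (Cell.edge (K.triSide t i).1 : K.Cell).shape)
      (hx : (x : ℂ) = AffineMap.lineMap (triCorner i) (triCorner (i + 1)) s)
      (hy : (y : ℂ) = bif (K.triSide t i).2 then (s : ℂ) else 1 - (s : ℂ)) :
      Glue ⟨.tri t, x⟩ ⟨.edge (K.triSide t i).1, y⟩
  | loz (l : K.Loz) (i : Fin 4) (s : ℝ) (x : (Cell.loz l : K.Cell).shape)
      (y : (Cell.edge (K.lozSide l i).1 : K.Cell).shape)
      (hx : (x : ℂ) = AffineMap.lineMap (lozCorner i) (lozCorner (i + 1)) s)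
      (hy : (y : ℂ) = bif (K.lozSide l i).2 then (s : ℂ) else 1 - (s : ℂ)) :
      Glue ⟨.loz l, x⟩ ⟨.edge (K.lozSide l i).1, y⟩

/-- The topological space underlying a complex: the disjoint union of its closed cells modulo the
equivalence relation generated by the gluing, with the quotient topology. -/
def Realization : Type := Quot K.Glue

instance : TopologicalSpace K.Realization := inferInstanceAs (TopologicalSpace (Quot K.Glue))

variable {K}

/-- The characteristic map of a closed cell. -/
def charMap (c : K.Cell) (x : c.shape) : K.Realization := Quot.mk K.Glue ⟨c, x⟩

/-- A map between complexes which carries every closed cell isometrically onto a closed cell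
(hence vertices to vertices, edges to edges, triangles to triangles, lozenges to lozenges). -/
def IsCellwiseIsometric {K L : LozengeComplex} (p : K.Realization → L.Realization) : Prop :=
  ∀ c : K.Cell, ∃ (d : L.Cell) (φ : c.shape ≃ᵢ d.shape),
    ∀ x, p (charMap c x) = charMap d (φ x)

/-- Attach further lozenges to a complex, along closed edge paths of length four. -/
def attachLozenges (K : LozengeComplex) (Loz' : Type) (side : Loz' → Fin 4 → K.Edge × Bool)
    (closed : ∀ l i,
      (bif (side l (i + 1)).2 then K.src (side l (i + 1)).1 else K.tgt (side l (i + 1)).1) =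
        (bif (side l i).2 then K.tgt (side l i).1 else K.src (side l i).1)) :
    LozengeComplex where
  Vert := K.Vert
  Edge := K.Edge
  Tri := K.Tri
  Loz := K.Loz ⊕ Loz'
  src := K.src
  tgt := K.tgt
  triSide := K.triSide
  lozSide := Sum.elim K.lozSide side
  tri_closed := K.tri_closed
  loz_closed := by
    rintro (l | l) i
    · exact K.loz_closed l i
    · exact closed l i

end LozengeComplex

/-- A universal covering: a surjective covering map with simply connected total space. -/
def IsUniversalCover {E B : Type*} [TopologicalSpace E] [TopologicalSpace B] (p : E → B) : Prop :=
  IsCoveringMap p ∧ Function.Surjective p ∧ SimplyConnectedSpace E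

/-! The surface `S` and the complex `V`. -/

namespace HamiltonianSurface

/-- The names of the three lozenges (and of the three sides of each triangle). -/
inductive Letter : Type
  | x | y | z

/-- The names of the four triangles. -/
inductive Index : Type
  | a | b | c | d

/-- The twelve edges `x_a, …, z_d`. -/
abbrev Edge : Type := Letter × Index

/-- The initial vertex of an edge depends only on its letter. -/
def src : Edge → Fin 3
  | (.x, _) => 0
  | (.y, _) => 1
  | (.z, _) => 2

/-- The terminal vertex of an edge depends only on its letter. -/
def tgt : Edge → Fin 3
  | (.x, _) => 1
  | (.y, _) => 2
  | (.z, _) => 0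

/-- Triangle `k` has boundary `x_k y_k z_k`. -/
def triSide (k : Index) : Fin 3 → Edge × Bool :=
  ![((.x, k), true), ((.y, k), true), ((.z, k), true)]

/-- The boundaries `x_c x_b⁻¹ x_d x_a⁻¹`, `y_b y_c⁻¹ y_d y_a⁻¹`, `z_c z_b⁻¹ z_d z_a⁻¹` of the
lozenges `x`, `y`, `z`, read from an acute corner. -/
def lozSide : Letter → Fin 4 → Edge × Bool
  | .x => ![((.x, .c), true), ((.x, .b), false), ((.x, .d), true), ((.x, .a), false)]
  | .y => ![((.y, .b), true), ((.y, .c), false), ((.y, .d), true), ((.y, .a), false)]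
  | .z => ![((.z, .c), true), ((.z, .b), false), ((.z, .d), true), ((.z, .a), false)]

/-- The boundaries `x_c⁻¹ x_b x_d⁻¹ x_a`, `y_b⁻¹ y_c y_d⁻¹ y_a`, `z_b⁻¹ z_c z_d⁻¹ z_a` of the
filling lozenges `x'`, `y'`, `z'`, read from an acute corner. -/
def fillSide : Letter → Fin 4 → Edge × Bool
  | .x => ![((.x, .c), false), ((.x, .b), true), ((.x, .d), false), ((.x, .a), true)]
  | .y => ![((.y, .b), false), ((.y, .c), true), ((.y, .d), false), ((.y, .a), true)]
  | .z => ![((.z, .b), false), ((.z, .c), true), ((.z, .d), false), ((.z, .a), true)]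

/-- The surface `S`, made of four triangles and three lozenges. -/
def surfaceS : LozengeComplex where
  Vert := Fin 3
  Edge := Edge
  Tri := Index
  Loz := Letter
  src := src
  tgt := tgt
  triSide := triSide
  lozSide := lozSide
  tri_closed := by intro t i; fin_cases i <;> rfl
  loz_closed := by intro l i; cases l <;> fin_cases i <;> rfl

/-- The complex `V`, obtained from `S` by gluing the lozenges `x'`, `y'`, `z'`. -/
def complexV : LozengeComplex :=
  surfaceS.attachLozenges Letter fillSide
    (by intro l i; cases l <;> fin_cases i <;> rfl)

end HamiltonianSurface

/-! The Brady complex `X`. -/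

namespace Brady

open FreeGroup in
/-- The relators `σ₁σ₃ = σ₃σ₁`, `σ₁σ₂σ₁ = σ₂σ₁σ₂`, `σ₂σ₃σ₂ = σ₃σ₂σ₃`, `(σ₁σ₂σ₃)⁴ = 1`. -/
def relators : Set (FreeGroup (Fin 3)) :=
  {of 0 * of 2 * (of 2 * of 0)⁻¹,
   of 0 * of 1 * of 0 * (of 1 * of 0 * of 1)⁻¹,
   of 1 * of 2 * of 1 * (of 2 * of 1 * of 2)⁻¹,
   (of 0 * of 1 * of 2) ^ 4}

/-- The quotient of the braid group on four strands by its center, which is generated by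
`(σ₁σ₂σ₃)⁴`. (It is isomorphic to a subgroup of index two in the automorphism group of the free
group of rank two.) -/
abbrev G : Type := PresentedGroup relators

/-- A standard generator. -/
def σ₁ : G := PresentedGroup.of 0

/-- A standard generator. -/
def σ₂ : G := PresentedGroup.of 1

/-- A standard generator. -/
def σ₃ : G := PresentedGroup.of 2

/-- The (dual) Garside element `δ = σ₁σ₂σ₃`. -/
def δ : G := σ₁ * σ₂ * σ₃

theorem comm13 : σ₁ * σ₃ = σ₃ * σ₁ := by
  have h := PresentedGroup.one_of_mem (rels := relators)
    (x := FreeGroup.of 0 * FreeGroup.of 2 * (FreeGroup.of 2 * FreeGroup.of 0)⁻¹)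
    (by simp [relators])
  rw [map_mul, map_inv, mul_inv_eq_one] at h
  simp only [map_mul, map_pow] at h
  exact h

theorem braid12 : σ₁ * σ₂ * σ₁ = σ₂ * σ₁ * σ₂ := by
  have h := PresentedGroup.one_of_mem (rels := relators)
    (x := FreeGroup.of 0 * FreeGroup.of 1 * FreeGroup.of 0 *
      (FreeGroup.of 1 * FreeGroup.of 0 * FreeGroup.of 1)⁻¹)
    (by simp [relators])
  rw [map_mul, map_inv, mul_inv_eq_one] at h
  simp only [map_mul, map_pow] at h
  exact h

theorem braid23 : σ₂ * σ₃ * σ₂ = σ₃ * σ₂ * σ₃ := by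
  have h := PresentedGroup.one_of_mem (rels := relators)
    (x := FreeGroup.of 1 * FreeGroup.of 2 * FreeGroup.of 1 *
      (FreeGroup.of 2 * FreeGroup.of 1 * FreeGroup.of 2)⁻¹)
    (by simp [relators])
  rw [map_mul, map_inv, mul_inv_eq_one] at h
  simp only [map_mul, map_pow] at h
  exact h

theorem delta_pow_four : δ ^ 4 = 1 := by
  have h := PresentedGroup.one_of_mem (rels := relators)
    (x := (FreeGroup.of 0 * FreeGroup.of 1 * FreeGroup.of 2) ^ 4)
    (by simp [relators])
  simp only [map_mul, map_pow] at h
  exact h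

theorem delta_mul_σ₁ : δ * σ₁ = σ₂ * δ := by
  calc δ * σ₁ = σ₁ * σ₂ * (σ₃ * σ₁) := by simp only [δ, mul_assoc]
    _ = (σ₁ * σ₂ * σ₁) * σ₃ := by rw [← comm13]; simp only [mul_assoc]
    _ = σ₂ * δ := by rw [braid12]; simp only [δ, mul_assoc]

theorem delta_mul_σ₂ : δ * σ₂ = σ₃ * δ := by
  calc δ * σ₂ = σ₁ * (σ₂ * σ₃ * σ₂) := by simp only [δ, mul_assoc]
    _ = (σ₁ * σ₃) * σ₂ * σ₃ := by rw [braid23]; simp only [mul_assoc]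
    _ = σ₃ * δ := by rw [comm13]; simp only [δ, mul_assoc]

theorem delta_sq_mul_σ₁ : δ ^ 2 * σ₁ = σ₃ * δ ^ 2 := by
  rw [pow_two, mul_assoc, delta_mul_σ₁, ← mul_assoc, delta_mul_σ₂, mul_assoc]

theorem σ₁_mul_delta_pow_three : σ₁ * δ * (σ₁ * δ) * (σ₁ * δ) = 1 := by
  calc σ₁ * δ * (σ₁ * δ) * (σ₁ * δ) = σ₁ * (δ * σ₁) * (δ * σ₁) * δ := by simp only [mul_assoc]
    _ = σ₁ * σ₂ * (δ * σ₂) * δ * δ := by rw [delta_mul_σ₁]; simp only [mul_assoc]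
    _ = δ ^ 4 := by rw [delta_mul_σ₂]; simp only [δ, pow_succ, pow_zero, one_mul, mul_assoc]
    _ = 1 := delta_pow_four

/-- Vertices of the Brady complex: cosets of the subgroup generated by `δ`. -/
abbrev Vert : Type := G ⧸ Subgroup.zpowers δ

theorem mk_mul_delta (g : G) : (QuotientGroup.mk (g * δ) : Vert) = QuotientGroup.mk g :=
  QuotientGroup.mk_mul_of_mem g (Subgroup.mem_zpowers δ)

theorem mk_mul_delta_sq (g : G) : (QuotientGroup.mk (g * δ ^ 2) : Vert) = QuotientGroup.mk g :=
  QuotientGroup.mk_mul_of_mem g (Subgroup.npow_mem_zpowers δ 2)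

/-- The Brady complex. The group `G` acts on it by left multiplication.

* The vertices are the cosets `[g] = g⟨δ⟩`.
* The edges are the elements `g` of `G`; the edge `g` joins `[g]` to `[g σ₁]`. As conjugation by
  `δ` permutes `σ₁`, `σ₂`, `σ₃`, `σ₄ := δ σ₃ δ⁻¹` cyclically, these are the edges joining `[g]` to
  `[g σ]` for `σ` one of these four generators.
* The triangles are those with vertices `[g]`, `[g σ₁]`, `[g σ₁ σ₂]` (note that
  `[g σ₁ σ₂ σ₃] = [g]`), one for each coset `g⟨σ₁ δ⟩`, as `σ₁ δ` permutes these three vertices.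
* The lozenges are those with vertices `[g σ₁]`, `[g σ₁ σ₃]`, `[g σ₃]`, `[g]`, one for each coset
  `g⟨δ²⟩`, as `δ²` exchanges `σ₁` and `σ₃`; the obtuse corners are `[g]` and `[g σ₁ σ₃]`.

The representative of a coset chosen by `Quotient.out` only affects which corner of the face is
listed first. -/
noncomputable def bradyComplex : LozengeComplex where
  Vert := Vert
  Edge := G
  Tri := G ⧸ Subgroup.zpowers (σ₁ * δ)
  Loz := G ⧸ Subgroup.zpowers (δ ^ 2)
  src g := QuotientGroup.mk g
  tgt g := QuotientGroup.mk (g * σ₁)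
  triSide t :=
    ![(t.out, true), (t.out * (σ₁ * δ), true), (t.out * (σ₁ * δ) * (σ₁ * δ), true)]
  lozSide l :=
    ![(l.out * σ₁ * δ ^ 2, true), (l.out * σ₃, false), (l.out * δ ^ 2, false), (l.out, true)]
  tri_closed := by
    intro t i
    generalize t.out = g
    fin_cases i
    · change (QuotientGroup.mk (g * (σ₁ * δ)) : Vert) = QuotientGroup.mk (g * σ₁)
      rw [← mul_assoc, mk_mul_delta]
    · change (QuotientGroup.mk (g * (σ₁ * δ) * (σ₁ * δ)) : Vert) =
        QuotientGroup.mk (g * (σ₁ * δ) * σ₁)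
      rw [← mul_assoc (g * (σ₁ * δ)), mk_mul_delta]
    · change (QuotientGroup.mk g : Vert) = QuotientGroup.mk (g * (σ₁ * δ) * (σ₁ * δ) * σ₁)
      rw [← mk_mul_delta (g * (σ₁ * δ) * (σ₁ * δ) * σ₁)]
      congr 1
      rw [mul_assoc _ σ₁ δ, mul_assoc g, mul_assoc g, σ₁_mul_delta_pow_three, mul_one]
  loz_closed := by
    intro l i
    generalize l.out = g
    fin_cases i
    · change (QuotientGroup.mk (g * σ₃ * σ₁) : Vert) = QuotientGroup.mk (g * σ₁ * δ ^ 2 * σ₁)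
      rw [mul_assoc _ (δ ^ 2), delta_sq_mul_σ₁, ← mul_assoc, mk_mul_delta_sq, mul_assoc g,
        mul_assoc g, comm13]
    · change (QuotientGroup.mk (g * δ ^ 2 * σ₁) : Vert) = QuotientGroup.mk (g * σ₃)
      rw [mul_assoc, delta_sq_mul_σ₁, ← mul_assoc, mk_mul_delta_sq]
    · change (QuotientGroup.mk g : Vert) = QuotientGroup.mk (g * δ ^ 2)
      rw [mk_mul_delta_sq]
    · change (QuotientGroup.mk (g * σ₁ * δ ^ 2) : Vert) = QuotientGroup.mk (g * σ₁)
      rw [mk_mul_delta_sq]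

end Brady

/-! ### Skew coordinates in the Euclidean plane -/

/-! The covering comes from a right action of `G` on the twelve edges of `V` (`edgeAction`), in
which `σ₁` and `σ₃` act by the same permutation. Sending an edge `g` of `X` to the translate of
`x_a` by `g` matches the two complexes cell by cell. The orbits of `δ` are the three sets of four
edges leaving a vertex of `V` (with suitable reorientations), the orbits of `σ₁δ` are the edge sets
of the four triangles, and the orbits of `δ²` correspond to the six lozenges. Since `δ` acts freely,
the map is bijective on edge ends at each vertex; since each edge lies on one triangle and two
lozenges both in `X` and in `V`, it is bijective on faces around each edge
(`Brady.isCovering_covering`). What concerns `V` is a finite check.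

That such a morphism is a topological covering is proved with open stars. The star of a vertex, edge
or face is an open saturated set in the disjoint union of the models. The preimage of a star is the
union of the stars of the cells above, each of which maps bijectively and openly
(`isCoveringMap_quotMap`, `Hom.IsCovering.isCoveringMap_realization`).

Simple connectedness is proved with path characters, that is, homomorphisms from the fundamental
groupoid to a group. A path connected space is simply connected if each of them is a coboundary. On
a complex a character restricts to a cocycle on the edges; a primitive on the vertices extends along
straight segments to the cells, is a primitive on each star because stars contract, and hence is one
globally (`simplyConnectedSpace_realization`). On `X`, a cocycle with values in `π` twists right
multiplication by the generators to permutations of `G × π`. The triangle and lozenge conditions are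
what makes these satisfy the relations of `G`, so `G` acts, and the orbit of `(1, 1)` is the graph
of a primitive (`Brady.exists_eq_mul`). No normal form in `G` is needed. -/

namespace LozengeComplex

/-- The first coordinate with respect to the basis `1`, `omega`. -/
noncomputable def coordA (z : ℂ) : ℝ := z.re - z.im / √3

/-- The second coordinate with respect to the basis `1`, `omega`. -/
noncomputable def coordB (z : ℂ) : ℝ := 2 * z.im / √3

/-- The point with given coordinates with respect to the basis `1`, `omega`. -/
noncomputable def point (a b : ℝ) : ℂ := ⟨a + b / 2, b * √3 / 2⟩

theorem sqrt_three_ne_zero : (√3 : ℝ) ≠ 0 := by positivity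

@[simp] theorem coordA_point (a b : ℝ) : coordA (point a b) = a := by
  have := sqrt_three_ne_zero
  simp only [coordA, point]; field_simp; ring

@[simp] theorem coordB_point (a b : ℝ) : coordB (point a b) = b := by
  have := sqrt_three_ne_zero
  simp only [coordB, point]; field_simp

theorem point_coord (z : ℂ) : point (coordA z) (coordB z) = z := by
  have := sqrt_three_ne_zero
  apply Complex.ext <;> simp only [coordA, coordB, point] <;> field_simp
  ring

@[simp] theorem coordA_zero : coordA 0 = 0 := by simp [coordA]
@[simp] theorem coordB_zero : coordB 0 = 0 := by simp [coordB]
@[simp] theorem coordA_one : coordA 1 = 1 := by simp [coordA]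
@[simp] theorem coordB_one : coordB 1 = 0 := by simp [coordB]

@[simp] theorem coordA_omega : coordA omega = 0 := by
  have := sqrt_three_ne_zero
  simp only [coordA, omega]; field_simp; ring

@[simp] theorem coordB_omega : coordB omega = 1 := by
  have := sqrt_three_ne_zero
  simp only [coordB, omega]; field_simp

@[simp] theorem coordA_add (z w : ℂ) : coordA (z + w) = coordA z + coordA w := by
  simp only [coordA, Complex.add_re, Complex.add_im]; ring

@[simp] theorem coordB_add (z w : ℂ) : coordB (z + w) = coordB z + coordB w := by
  simp only [coordB, Complex.add_im]; ring

@[simp] theorem coordA_sub (z w : ℂ) : coordA (z - w) = coordA z - coordA w := by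
  simp only [coordA, Complex.sub_re, Complex.sub_im]; ring

@[simp] theorem coordB_sub (z w : ℂ) : coordB (z - w) = coordB z - coordB w := by
  simp only [coordB, Complex.sub_im]; ring

theorem coordA_lineMap (z w : ℂ) (s : ℝ) :
    coordA (AffineMap.lineMap z w s) = (1 - s) * coordA z + s * coordA w := by
  simp [coordA, AffineMap.lineMap_apply]; ring

theorem coordB_lineMap (z w : ℂ) (s : ℝ) :
    coordB (AffineMap.lineMap z w s) = (1 - s) * coordB z + s * coordB w := by
  simp [coordB, AffineMap.lineMap_apply]; ring

theorem continuous_coordA : Continuous coordA := by unfold coordA; fun_prop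

theorem continuous_coordB : Continuous coordB := by unfold coordB; fun_prop

theorem ext_coord {z w : ℂ} (ha : coordA z = coordA w) (hb : coordB z = coordB w) : z = w := by
  rw [← point_coord z, ha, hb, point_coord]

/-- The cross term arises because `omega` has real part `1 / 2`. Isometry of a map given in skew
coordinates thus becomes a polynomial identity. -/
theorem normSq_eq_coord (z : ℂ) :
    Complex.normSq z = coordA z ^ 2 + coordA z * coordB z + coordB z ^ 2 := by
  have h3 : (√3 : ℝ) ^ 2 = 3 := Real.sq_sqrt (by norm_num)
  rw [Complex.normSq_apply, coordA, coordB]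
  field_simp
  ring_nf
  rw [h3]

theorem dist_eq_of_coord {z w z' w' : ℂ}
    (h : coordA (z - w) ^ 2 + coordA (z - w) * coordB (z - w) + coordB (z - w) ^ 2 =
      coordA (z' - w') ^ 2 + coordA (z' - w') * coordB (z' - w') + coordB (z' - w') ^ 2) :
    dist z w = dist z' w' := by
  rw [Complex.dist_eq, Complex.dist_eq, Complex.norm_def, Complex.norm_def, normSq_eq_coord,
    normSq_eq_coord, h]

/-! ### Model polygons -/

section Regions

variable {n : ℕ} [NeZero n] (h : Fin n → ℂ → ℝ)

/-- The points near corner `i`, in terms of the distances `h j` to the sides. -/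
def NearCorner (i : Fin n) (z : ℂ) : Prop := h (i - 1) z + h i z < 1 / 2

/-- The points near side `i`, in terms of the distances `h j` to the sides. -/
def NearSide (i : Fin n) (z : ℂ) : Prop := h i z < h (i + 1) z ∧ h i z < h (i - 1) z

/-- The interior points, in terms of the distances `h j` to the sides. -/
def Inside (z : ℂ) : Prop := ∀ i, 0 < h i z

end Regions

/-- A convex polygon with sides of length `1`, given by its corners and by its height functions:
`height i` is proportional to the distance to side `i`. -/
structure PolyModel (n : ℕ) [NeZero n] where
  corner : Fin n → ℂ
  height : Fin n → ℂ → ℝ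
  continuous_height : ∀ i, Continuous (height i)
  height_lineMap : ∀ i z w (s : ℝ),
    height i (AffineMap.lineMap z w s) = (1 - s) * height i z + s * height i w
  ext_height : ∀ z w, (∀ i, height i z = height i w) → z = w
  height_corner_nonneg : ∀ i j, 0 ≤ height i (corner j)
  -- The two heights adjacent to side `i` are `s` and `1 - s` along it, so the threshold `1 / 2`
  -- cuts each side at its midpoint, as the vertex stars cut an edge, and keeps different corner
  -- regions disjoint.
  nearCorner_side : ∀ i j (s : ℝ), 0 ≤ s → s ≤ 1 →
    (NearCorner height j (AffineMap.lineMap (corner i) (corner (i + 1)) s) ↔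
      (j = i ∧ s < 1 / 2) ∨ (j = i + 1 ∧ 1 / 2 < s))
  nearSide_side : ∀ i j (s : ℝ), 0 ≤ s → s ≤ 1 →
    (NearSide height j (AffineMap.lineMap (corner i) (corner (i + 1)) s) ↔
      j = i ∧ 0 < s ∧ s < 1)
  height_side : ∀ i (s : ℝ), height i (AffineMap.lineMap (corner i) (corner (i + 1)) s) = 0
  nearCorner_unique : ∀ i j z, (∀ k, 0 ≤ height k z) → NearCorner height i z →
    NearCorner height j z → i = j
  nearSide_unique : ∀ i j z, NearSide height i z → NearSide height j z → i = j
  covered : ∀ z, (∀ k, 0 ≤ height k z) →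
    Inside height z ∨ (∃ i, NearCorner height i z) ∨ ∃ i, NearSide height i z

/-- The heights in the model triangle. -/
noncomputable def triHeight : Fin 3 → ℂ → ℝ :=
  ![fun z => coordB z, fun z => 1 - coordA z - coordB z, fun z => coordA z]

/-- The heights in the model lozenge. -/
noncomputable def lozHeight : Fin 4 → ℂ → ℝ :=
  ![fun z => coordB z, fun z => 1 - coordA z, fun z => 1 - coordB z, fun z => coordA z]

/-- The model triangle. -/
noncomputable def triModel : PolyModel 3 where
  corner := triCorner
  height := triHeight
  continuous_height i := by
    have := continuous_coordA
    have := continuous_coordB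
    fin_cases i <;> (simp [triHeight]; fun_prop)
  height_lineMap i z w s := by
    fin_cases i <;> simp [triHeight, coordA_lineMap, coordB_lineMap] <;> ring
  ext_height z w h := ext_coord (h 2) (h 0)
  height_corner_nonneg i j := by
    fin_cases i <;> fin_cases j <;> simp [triHeight, triCorner]
  nearCorner_side i j s h0 h1 := by
    fin_cases i <;> fin_cases j <;>
    simp [NearCorner, triHeight, triCorner, coordA_lineMap, coordB_lineMap] <;> grind
  nearSide_side i j s h0 h1 := by
    fin_cases i <;> fin_cases j <;>
    simp [NearSide, triHeight, triCorner, coordA_lineMap, coordB_lineMap] <;> grind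
  height_side i s := by
    fin_cases i <;>
    simp [triHeight, triCorner, coordA_lineMap, coordB_lineMap]
  nearCorner_unique i j z h hi hj := by
    have h0 := h 0
    have h1 := h 1
    have h2 := h 2
    fin_cases i <;> fin_cases j <;> simp [NearCorner, triHeight] at h0 h1 h2 hi hj ⊢ <;> linarith
  nearSide_unique i j z hi hj := by
    fin_cases i <;> fin_cases j <;> simp [NearSide, triHeight] at hi hj ⊢ <;> linarith
  covered z h := by
    have h0 := h 0
    have h1 := h 1
    have h2 := h 2
    simp only [Inside, Fin.forall_fin_succ, Fin.exists_fin_succ, NearCorner, NearSide]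
    simp [triHeight] at h0 h1 h2 ⊢
    grind

/-- The model lozenge. -/
noncomputable def lozModel : PolyModel 4 where
  corner := lozCorner
  height := lozHeight
  continuous_height i := by
    have := continuous_coordA
    have := continuous_coordB
    fin_cases i <;> (simp [lozHeight]; fun_prop)
  height_lineMap i z w s := by
    fin_cases i <;> simp [lozHeight, coordA_lineMap, coordB_lineMap] <;> ring
  ext_height z w h := ext_coord (h 3) (h 0)
  height_corner_nonneg i j := by
    fin_cases i <;> fin_cases j <;> simp [lozHeight, lozCorner]
  nearCorner_side i j s h0 h1 := by
    fin_cases i <;> fin_cases j <;>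
    simp [NearCorner, lozHeight, lozCorner, coordA_lineMap, coordB_lineMap] <;> grind
  nearSide_side i j s h0 h1 := by
    fin_cases i <;> fin_cases j <;>
    simp [NearSide, lozHeight, lozCorner, coordA_lineMap, coordB_lineMap] <;> grind
  height_side i s := by
    fin_cases i <;>
    simp [lozHeight, lozCorner, coordA_lineMap, coordB_lineMap]
  nearCorner_unique i j z h hi hj := by
    have h0 := h 0
    have h1 := h 1
    have h2 := h 2
    have h3 := h 3
    fin_cases i <;> fin_cases j <;> simp [NearCorner, lozHeight] at h0 h1 h2 h3 hi hj ⊢ <;> linarith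
  nearSide_unique i j z hi hj := by
    fin_cases i <;> fin_cases j <;> simp [NearSide, lozHeight] at hi hj ⊢ <;> linarith
  covered z h := by
    have h0 := h 0
    have h1 := h 1
    have h2 := h 2
    have h3 := h 3
    simp only [Inside, Fin.forall_fin_succ, Fin.exists_fin_succ, NearCorner, NearSide]
    simp [lozHeight] at h0 h1 h2 h3 ⊢
    grind

end LozengeComplex

/-! ### Closed model polygons and their symmetries -/

namespace LozengeComplex

namespace PolyModel

variable {n : ℕ} [NeZero n] (M : PolyModel n)

/-- The closed polygon. -/
abbrev shape : Set ℂ := convexHull ℝ (Set.range M.corner)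

theorem corner_mem (i : Fin n) : M.corner i ∈ M.shape :=
  subset_convexHull ℝ _ ⟨i, rfl⟩

theorem height_nonneg {z : ℂ} (hz : z ∈ M.shape) (i : Fin n) : 0 ≤ M.height i z := by
  have hc : Convex ℝ {z | 0 ≤ M.height i z} := by
    rw [convex_iff_segment_subset]
    intro x hx y hy
    rw [segment_eq_image_lineMap]
    rintro _ ⟨s, ⟨h0, h1⟩, rfl⟩
    rw [Set.mem_ofPred_eq, M.height_lineMap]
    exact add_nonneg (mul_nonneg (by linarith) hx) (mul_nonneg h0 hy)
  refine convexHull_min ?_ hc hz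
  rintro _ ⟨j, rfl⟩
  exact M.height_corner_nonneg i j

theorem isOpen_nearCorner (i : Fin n) : IsOpen {z | NearCorner M.height i z} :=
  isOpen_lt ((M.continuous_height _).add (M.continuous_height _)) continuous_const

theorem isOpen_nearSide (i : Fin n) : IsOpen {z | NearSide M.height i z} :=
  (isOpen_lt (M.continuous_height _) (M.continuous_height _)).inter
    (isOpen_lt (M.continuous_height _) (M.continuous_height _))

theorem isOpen_inside : IsOpen {z | Inside M.height z} := by
  simp only [Inside, Set.ofPred_forall]
  exact isOpen_iInter_of_finite fun i => isOpen_lt continuous_const (M.continuous_height i)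

end PolyModel

/-- A symmetry of a model polygon. If `refl` is `false` then side `i` is carried to side
`rot + i` preserving the direction of travel, otherwise to side `rot - i`, reversing it. -/
structure PolySym {n : ℕ} [NeZero n] (M : PolyModel n) where
  rot : Fin n
  refl : Bool
  toFun : ℂ → ℂ
  invFun : ℂ → ℂ
  height_toFun : ∀ i z, M.height i (toFun z) = M.height (bif refl then rot - i else i - rot) z
  height_invFun : ∀ i z, M.height i (invFun z) = M.height (bif refl then rot - i else rot + i) z
  toFun_corner : ∀ i, toFun (M.corner i) = M.corner (bif refl then rot - i + 1 else rot + i)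
  dist_toFun : ∀ z w, dist (toFun z) (toFun w) = dist z w

namespace PolySym

variable {n : ℕ} [NeZero n] {M : PolyModel n} (D : PolySym M)

/-- The action of a symmetry on the sides. -/
def side (i : Fin n) : Fin n := bif D.refl then D.rot - i else D.rot + i

/-- The inverse of the action of a symmetry on the sides. -/
def sideInv (i : Fin n) : Fin n := bif D.refl then D.rot - i else i - D.rot

/-- The action of a symmetry on the corners. -/
def cornerMap (i : Fin n) : Fin n := bif D.refl then D.rot - i + 1 else D.rot + i

@[simp] theorem sideInv_side (i : Fin n) : D.sideInv (D.side i) = i := by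
  simp only [side, sideInv]; cases D.refl <;> simp

@[simp] theorem side_sideInv (i : Fin n) : D.side (D.sideInv i) = i := by
  simp only [side, sideInv]; cases D.refl <;> simp

theorem height_side_toFun (i : Fin n) (z : ℂ) :
    M.height (D.side i) (D.toFun z) = M.height i z := by
  rw [D.height_toFun]
  exact congrArg (fun j => M.height j z) (D.sideInv_side i)

theorem height_invFun' (i : Fin n) (z : ℂ) :
    M.height i (D.invFun z) = M.height (D.side i) z := D.height_invFun i z

-- Heights separate points, so an identity between maps reduces to one between permutations of the
-- sides. Affinity of the symmetries follows in the same way from affinity of the heights.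
@[simp] theorem toFun_invFun (z : ℂ) : D.toFun (D.invFun z) = z := by
  refine M.ext_height _ _ fun i => ?_
  rw [← D.side_sideInv i, height_side_toFun, height_invFun', side_sideInv]

@[simp] theorem invFun_toFun (z : ℂ) : D.invFun (D.toFun z) = z := by
  refine M.ext_height _ _ fun i => ?_
  rw [height_invFun', height_side_toFun]

theorem toFun_lineMap (z w : ℂ) (s : ℝ) :
    D.toFun (AffineMap.lineMap z w s) = AffineMap.lineMap (D.toFun z) (D.toFun w) s := by
  refine M.ext_height _ _ fun i => ?_
  rw [D.height_toFun, M.height_lineMap, M.height_lineMap, D.height_toFun, D.height_toFun]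

theorem invFun_lineMap (z w : ℂ) (s : ℝ) :
    D.invFun (AffineMap.lineMap z w s) = AffineMap.lineMap (D.invFun z) (D.invFun w) s := by
  refine M.ext_height _ _ fun i => ?_
  rw [D.height_invFun, M.height_lineMap, M.height_lineMap, D.height_invFun, D.height_invFun]

theorem toFun_corner' (i : Fin n) : D.toFun (M.corner i) = M.corner (D.cornerMap i) :=
  D.toFun_corner i

theorem cornerMap_surjective : Function.Surjective D.cornerMap := by
  intro j
  simp only [cornerMap]
  cases D.refl
  · exact ⟨j - D.rot, by simp⟩
  · exact ⟨D.rot - (j - 1), by simp⟩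

theorem toFun_mem {z : ℂ} (hz : z ∈ M.shape) : D.toFun z ∈ M.shape := by
  have hc : Convex ℝ (D.toFun ⁻¹' M.shape) := by
    rw [convex_iff_segment_subset]
    intro x hx y hy
    rw [segment_eq_image_lineMap]
    rintro _ ⟨s, hs, rfl⟩
    rw [Set.mem_preimage, D.toFun_lineMap]
    exact (convex_convexHull ℝ _).lineMap_mem hx hy hs
  refine convexHull_min ?_ hc hz
  rintro _ ⟨j, rfl⟩
  rw [Set.mem_preimage, D.toFun_corner']
  exact M.corner_mem _

theorem invFun_mem {z : ℂ} (hz : z ∈ M.shape) : D.invFun z ∈ M.shape := by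
  have hc : Convex ℝ (D.invFun ⁻¹' M.shape) := by
    rw [convex_iff_segment_subset]
    intro x hx y hy
    rw [segment_eq_image_lineMap]
    rintro _ ⟨s, hs, rfl⟩
    rw [Set.mem_preimage, D.invFun_lineMap]
    exact (convex_convexHull ℝ _).lineMap_mem hx hy hs
  refine convexHull_min ?_ hc hz
  rintro _ ⟨j, rfl⟩
  obtain ⟨i, rfl⟩ := D.cornerMap_surjective j
  rw [Set.mem_preimage, ← D.toFun_corner', invFun_toFun]
  exact M.corner_mem _

theorem inside_toFun {z : ℂ} : Inside M.height (D.toFun z) ↔ Inside M.height z := by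
  constructor
  · intro h i
    rw [← D.height_side_toFun]
    exact h _
  · intro h i
    rw [← D.side_sideInv i, D.height_side_toFun]
    exact h _

theorem nearSide_toFun {i : Fin n} {z : ℂ} :
    NearSide M.height (D.side i) (D.toFun z) ↔ NearSide M.height i z := by
  have h1 := D.height_toFun (D.side i + 1) z
  have h2 := D.height_toFun (D.side i - 1) z
  simp only [NearSide, height_side_toFun, h1, h2]
  simp only [side]
  cases D.refl
  · simp only [cond_false]
    rw [show D.rot + i + 1 - D.rot = i + 1 by abel, show D.rot + i - 1 - D.rot = i - 1 by abel]
  · simp only [cond_true]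
    rw [show D.rot - (D.rot - i + 1) = i - 1 by abel,
      show D.rot - (D.rot - i - 1) = i + 1 by abel]
    exact and_comm

theorem nearCorner_toFun {i : Fin n} {z : ℂ} :
    NearCorner M.height (D.cornerMap i) (D.toFun z) ↔ NearCorner M.height i z := by
  simp only [NearCorner, D.height_toFun, cornerMap]
  cases D.refl
  · simp only [cond_false]
    rw [show D.rot + i - 1 - D.rot = i - 1 by abel, show D.rot + i - D.rot = i by abel]
  · simp only [cond_true]
    rw [show D.rot - (D.rot - i + 1 - 1) = i by abel,
      show D.rot - (D.rot - i + 1) = i - 1 by abel, add_comm]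

end PolySym

/-- The symmetry of the model triangle acting on sides as `i ↦ r + i` or `i ↦ r - i`. -/
noncomputable def triSym (r : Fin 3) (b : Bool) : PolySym triModel where
  rot := r
  refl := b
  -- In the triangle `coordA` and `coordB` are the heights over sides `2` and `0`, so the image is
  -- prescribed by these two heights; the third is determined because the heights add up to `1`.
  toFun z := point (triHeight (bif b then r - 2 else 2 - r) z)
      (triHeight (bif b then r - 0 else 0 - r) z)
  invFun z := point (triHeight (bif b then r - 2 else r + 2) z)
      (triHeight (bif b then r - 0 else r + 0) z)
  height_toFun i z := by
    fin_cases r <;> cases b <;> fin_cases i <;> simp [triModel, triHeight] <;> ring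
  height_invFun i z := by
    fin_cases r <;> cases b <;> fin_cases i <;> simp [triModel, triHeight] <;> ring
  toFun_corner i := by
    fin_cases r <;> cases b <;> fin_cases i <;> apply ext_coord <;>
      simp [triModel, triHeight, triCorner, show (-2 + 1 : Fin 3) = 2 from rfl]
  dist_toFun z w := by
    apply dist_eq_of_coord
    fin_cases r <;> cases b <;> simp [triHeight] <;> ring

/-- The symmetries of the model lozenge: the identity and the half turn, which act on sides by
`i ↦ i` and `i ↦ 2 + i`, and the two reflections, which act by `i ↦ 3 - i` and `i ↦ 1 - i`. -/
noncomputable def lozSym (half b : Bool) : PolySym lozModel where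
  rot := bif b then (bif half then 1 else 3) else (bif half then 2 else 0)
  refl := b
  -- Exchanging the coordinates reflects in the long diagonal, and replacing both by their
  -- complements to `1` is the half turn. All four maps are involutions, so the inverse has the same
  -- formula.
  toFun z := point
    (bif half then 1 - (bif b then coordB z else coordA z) else (bif b then coordB z else coordA z))
    (bif half then 1 - (bif b then coordA z else coordB z) else (bif b then coordA z else coordB z))
  invFun z := point
    (bif half then 1 - (bif b then coordB z else coordA z) else (bif b then coordB z else coordA z))
    (bif half then 1 - (bif b then coordA z else coordB z) else (bif b then coordA z else coordB z))
  height_toFun i z := by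
    cases half <;> cases b <;> fin_cases i <;> simp [lozModel, lozHeight]
  height_invFun i z := by
    cases half <;> cases b <;> fin_cases i <;> simp [lozModel, lozHeight]
  toFun_corner i := by
    cases half <;> cases b <;> fin_cases i <;> apply ext_coord <;> simp [lozModel, lozCorner]
  dist_toFun z w := by
    apply dist_eq_of_coord
    cases half <;> cases b <;> simp <;> ring

end LozengeComplex

/-! ### Facets, the gluing relation and open stars -/

namespace LozengeComplex

variable (K : LozengeComplex)

/-- The vertex at which an oriented edge starts. -/
def start (s : K.Edge × Bool) : K.Vert := bif s.2 then K.src s.1 else K.tgt s.1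

/-- The vertex at which an oriented edge ends. -/
def finish (s : K.Edge × Bool) : K.Vert := bif s.2 then K.tgt s.1 else K.src s.1

/-- The closed cell `d'` is a facet of the closed cell `d`; it is embedded into the model of `d` as
the segment from `p` to `q`, in the direction of its reference orientation (a vertex of an edge is
embedded as a constant segment). -/
inductive IsFacet : K.Cell → K.Cell → ℂ → ℂ → Prop
  | src (e : K.Edge) : IsFacet (.edge e) (.vert (K.src e)) 0 0
  | tgt (e : K.Edge) : IsFacet (.edge e) (.vert (K.tgt e)) 1 1
  | tri (t : K.Tri) (i : Fin 3) : IsFacet (.tri t) (.edge (K.triSide t i).1)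
      (triCorner (bif (K.triSide t i).2 then i else i + 1))
      (triCorner (bif (K.triSide t i).2 then i + 1 else i))
  | loz (l : K.Loz) (i : Fin 4) : IsFacet (.loz l) (.edge (K.lozSide l i).1)
      (lozCorner (bif (K.lozSide l i).2 then i else i + 1))
      (lozCorner (bif (K.lozSide l i).2 then i + 1 else i))

variable {K}

theorem mem_edgeShape {z : ℂ} : z ∈ segment ℝ (0 : ℂ) 1 ↔ z.im = 0 ∧ 0 ≤ z.re ∧ z.re ≤ 1 := by
  rw [segment_eq_image_lineMap]
  constructor
  · rintro ⟨s, ⟨h0, h1⟩, rfl⟩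
    simp [AffineMap.lineMap_apply, h0, h1]
  · rintro ⟨h, h0, h1⟩
    refine ⟨z.re, ⟨h0, h1⟩, ?_⟩
    apply Complex.ext <;> simp [AffineMap.lineMap_apply, h]

theorem ofReal_re_of_mem {z : ℂ} (hz : z ∈ segment ℝ (0 : ℂ) 1) : (z.re : ℂ) = z :=
  Complex.ext rfl (mem_edgeShape.1 hz).1.symm

theorem PreRealization.ext {a b : K.PreRealization} (h : a.1 = b.1) (h' : (a.2 : ℂ) = b.2) :
    a = b := by
  obtain ⟨c, x, hx⟩ := a
  obtain ⟨d, y, hy⟩ := b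
  obtain rfl : c = d := h
  obtain rfl : x = y := h'
  rfl

theorem Cell.convex_shape (c : K.Cell) : Convex ℝ c.shape := by
  cases c
  · exact convex_singleton _
  · exact convex_segment _ _
  · exact convex_convexHull ℝ _
  · exact convex_convexHull ℝ _

theorem Cell.zero_mem (c : K.Cell) : (0 : ℂ) ∈ c.shape := by
  cases c
  · rfl
  · exact left_mem_segment ℝ _ _
  · exact triModel.corner_mem 0
  · exact lozModel.corner_mem 0

/-- This merges the four kinds of gluing into one formula, parametrised by the facet in its own
reference orientation. For a vertex the embedded segment is constant and the parameter is `0`. -/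
theorem glue_iff {a b : K.PreRealization} :
    K.Glue a b ↔ ∃ p q, K.IsFacet a.1 b.1 p q ∧
      (a.2 : ℂ) = AffineMap.lineMap p q (b.2 : ℂ).re := by
  constructor
  · rintro (⟨e, x, y, hx⟩ | ⟨e, x, y, hx⟩ | ⟨t, i, s, x, y, hx, hy⟩ | ⟨t, i, s, x, y, hx, hy⟩)
    · exact ⟨_, _, .src e, by simp [hx]⟩
    · exact ⟨_, _, .tgt e, by simp [hx]⟩
    · refine ⟨_, _, .tri t i, ?_⟩
      dsimp only
      rw [hx, hy]
      cases (K.triSide t i).2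
      · simp [AffineMap.lineMap_apply_one_sub]
      · simp
    · refine ⟨_, _, .loz t i, ?_⟩
      dsimp only
      rw [hx, hy]
      cases (K.lozSide t i).2
      · simp [AffineMap.lineMap_apply_one_sub]
      · simp
  · obtain ⟨c, x⟩ := a
    obtain ⟨d, y⟩ := b
    rintro ⟨p, q, h, hx⟩
    dsimp only at h hx
    cases h with
    | src e => exact .src e x y (by simpa using hx)
    | tgt e => exact .tgt e x y (by simpa using hx)
    | tri t i =>
      refine .tri t i (bif (K.triSide t i).2 then (y : ℂ).re else 1 - (y : ℂ).re) x y ?_ ?_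
      · rw [hx]
        cases (K.triSide t i).2
        · simp [AffineMap.lineMap_apply_one_sub]
        · simp
      · have := ofReal_re_of_mem y.2
        cases (K.triSide t i).2
        · simp [this]
        · simp [this]
    | loz t i =>
      refine .loz t i (bif (K.lozSide t i).2 then (y : ℂ).re else 1 - (y : ℂ).re) x y ?_ ?_
      · rw [hx]
        cases (K.lozSide t i).2
        · simp [AffineMap.lineMap_apply_one_sub]
        · simp
      · have := ofReal_re_of_mem y.2
        cases (K.lozSide t i).2
        · simp [this]
        · simp [this]

theorem IsFacet.mem {c d : K.Cell} {p q : ℂ} (h : K.IsFacet c d p q) :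
    p ∈ c.shape ∧ q ∈ c.shape := by
  cases h with
  | src e => exact ⟨left_mem_segment ℝ _ _, left_mem_segment ℝ _ _⟩
  | tgt e => exact ⟨right_mem_segment ℝ _ _, right_mem_segment ℝ _ _⟩
  | tri t i => exact ⟨triModel.corner_mem _, triModel.corner_mem _⟩
  | loz t i => exact ⟨lozModel.corner_mem _, lozModel.corner_mem _⟩

theorem Cell.re_mem {c : K.Cell} (h : ∃ d p q, K.IsFacet d c p q) {y : ℂ} (hy : y ∈ c.shape) :
    y.re ∈ Set.Icc (0 : ℝ) 1 := by
  obtain ⟨d, p, q, h⟩ := h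
  cases h with
  | src e => obtain rfl : y = 0 := hy; simp
  | tgt e => obtain rfl : y = 0 := hy; simp
  | tri t i => exact (mem_edgeShape.1 hy).2
  | loz t i => exact (mem_edgeShape.1 hy).2

theorem IsFacet.charMap_eq {c d : K.Cell} {p q : ℂ} (h : K.IsFacet c d p q) {x y : ℂ}
    (hx : x ∈ c.shape) (hy : y ∈ d.shape) (hxy : x = AffineMap.lineMap p q y.re) :
    charMap c ⟨x, hx⟩ = charMap d ⟨y, hy⟩ :=
  Quot.sound (glue_iff.2 ⟨p, q, h, hxy⟩)

/-! ### Stars of cells -/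

section Polygon

variable {n : ℕ} [NeZero n] (M : PolyModel n) (side : Fin n → K.Edge × Bool)

/-- The point `z` of a polygon is close to a corner `m` at which the vertex `v` is attached. -/
def PolyStarVert (z : ℂ) (v : K.Vert) (m : ℂ) : Prop :=
  ∃ i, NearCorner M.height i z ∧ K.start (side i) = v ∧ m = M.corner i

/-- The point `z` of a polygon is close to a side at which the edge `e` is attached, and `m` is
the corner which is the initial point of `e`. -/
def PolyStarEdge (z : ℂ) (e : K.Edge) (m : ℂ) : Prop :=
  ∃ i, NearSide M.height i z ∧ (side i).1 = e ∧ m = M.corner (bif (side i).2 then i else i + 1)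

end Polygon

/-- The point `z` of the model of the closed cell `d` lies in the open star of the cell `c`, and
in this star it is contracted to the point `m` of the model of `d`. -/
def StarAt : K.Cell → ℂ → K.Cell → ℂ → Prop
  | .vert w, _, .vert v, m => w = v ∧ m = 0
  | .edge e, z, .vert v, m =>
      (z.re < 1 / 2 ∧ K.src e = v ∧ m = 0) ∨ (1 / 2 < z.re ∧ K.tgt e = v ∧ m = 1)
  | .tri t, z, .vert v, m => PolyStarVert triModel (K.triSide t) z v m
  | .loz l, z, .vert v, m => PolyStarVert lozModel (K.lozSide l) z v m
  | .edge e', z, .edge e, m => e' = e ∧ (0 < z.re ∧ z.re < 1) ∧ m = 0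
  | .tri t, z, .edge e, m => PolyStarEdge triModel (K.triSide t) z e m
  | .loz l, z, .edge e, m => PolyStarEdge lozModel (K.lozSide l) z e m
  | .tri t', z, .tri t, m => t' = t ∧ Inside triModel.height z ∧ m = 0
  | .loz l', z, .loz l, m => l' = l ∧ Inside lozModel.height z ∧ m = 0
  | _, _, _, _ => False

section Polygon

variable {n : ℕ} [NeZero n] {M : PolyModel n} {side : Fin n → K.Edge × Bool}

/-- Along a side only its two end corners are near, each on its own half. Closedness of the boundary
identifies the vertex at corner `i + 1` with the end of side `i`, so the trace of a vertex star is
the vertex star of the edge. -/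
theorem polyStarVert_side (hside : ∀ i, K.start (side (i + 1)) = K.finish (side i)) (i : Fin n)
    {s : ℝ} (h0 : 0 ≤ s) (h1 : s ≤ 1) (v : K.Vert) (m : ℂ) :
    PolyStarVert M side (AffineMap.lineMap (M.corner (bif (side i).2 then i else i + 1))
        (M.corner (bif (side i).2 then i + 1 else i)) s) v m ↔
      (s < 1 / 2 ∧ K.src (side i).1 = v ∧ m = M.corner (bif (side i).2 then i else i + 1)) ∨
      (1 / 2 < s ∧ K.tgt (side i).1 = v ∧ m = M.corner (bif (side i).2 then i + 1 else i)) := by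
  have key := hside i
  simp only [start, finish] at key
  cases hb : (side i).2 <;> simp only [hb, cond_true, cond_false, PolyStarVert, start] at key ⊢
  · rw [← AffineMap.lineMap_apply_one_sub]
    simp only [M.nearCorner_side i _ (1 - s) (by linarith) (by linarith)]
    constructor
    · rintro ⟨j, (⟨rfl, hs⟩ | ⟨rfl, hs⟩), rfl, rfl⟩
      · right; exact ⟨by linarith, by simp [hb], rfl⟩
      · left; exact ⟨by linarith, key.symm, rfl⟩
    · rintro (⟨hs, rfl, rfl⟩ | ⟨hs, rfl, rfl⟩)
      · exact ⟨i + 1, .inr ⟨rfl, by linarith⟩, key, rfl⟩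
      · exact ⟨i, .inl ⟨rfl, by linarith⟩, by simp [hb], rfl⟩
  · simp only [M.nearCorner_side i _ s h0 h1]
    constructor
    · rintro ⟨j, (⟨rfl, hs⟩ | ⟨rfl, hs⟩), rfl, rfl⟩
      · left; exact ⟨by linarith, by simp [hb], rfl⟩
      · right; exact ⟨by linarith, key.symm, rfl⟩
    · rintro (⟨hs, rfl, rfl⟩ | ⟨hs, rfl, rfl⟩)
      · exact ⟨i, .inl ⟨rfl, by linarith⟩, by simp [hb], rfl⟩
      · exact ⟨i + 1, .inr ⟨rfl, by linarith⟩, key, rfl⟩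

theorem polyStarEdge_side (i : Fin n)
    {s : ℝ} (h0 : 0 ≤ s) (h1 : s ≤ 1) (e : K.Edge) (m : ℂ) :
    PolyStarEdge M side (AffineMap.lineMap (M.corner (bif (side i).2 then i else i + 1))
        (M.corner (bif (side i).2 then i + 1 else i)) s) e m ↔
      (side i).1 = e ∧ (0 < s ∧ s < 1) ∧ m = M.corner (bif (side i).2 then i else i + 1) := by
  have key : ∀ j, NearSide M.height j (AffineMap.lineMap
      (M.corner (bif (side i).2 then i else i + 1))
        (M.corner (bif (side i).2 then i + 1 else i)) s) ↔ j = i ∧ 0 < s ∧ s < 1 := by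
    intro j
    cases hb : (side i).2 <;> simp only [cond_true, cond_false]
    · rw [← AffineMap.lineMap_apply_one_sub]
      rw [M.nearSide_side i _ (1 - s) (by linarith) (by linarith)]
      constructor <;> rintro ⟨rfl, h, h'⟩ <;> exact ⟨rfl, by linarith, by linarith⟩
    · exact M.nearSide_side i _ s h0 h1
  simp only [PolyStarEdge, key]
  constructor
  · rintro ⟨j, ⟨rfl, hs⟩, rfl, rfl⟩
    exact ⟨rfl, hs, rfl⟩
  · rintro ⟨rfl, hs, rfl⟩
    exact ⟨i, ⟨rfl, hs⟩, rfl, rfl⟩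

theorem not_inside_side (i : Fin n) (b : Bool) (s : ℝ) :
    ¬ Inside M.height (AffineMap.lineMap (M.corner (bif b then i else i + 1))
        (M.corner (bif b then i + 1 else i)) s) := by
  intro h
  have := h i
  cases b <;> simp only [cond_true, cond_false] at this
  · rw [← AffineMap.lineMap_apply_one_sub, M.height_side] at this
    exact lt_irrefl _ this
  · rw [M.height_side] at this
    exact lt_irrefl _ this

end Polygon

/-- Stars are compatible with the gluing. -/
theorem starAt_facet {c d : K.Cell} {p q : ℂ} (h : K.IsFacet c d p q) {y : ℂ} (hy : y ∈ d.shape)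
    {x : ℂ} (hx : x = AffineMap.lineMap p q y.re) (k : K.Cell) (m : ℂ) :
    StarAt c x k m ↔ ∃ m', m = AffineMap.lineMap p q m'.re ∧ StarAt d y k m' := by
  subst hx
  have h01 := Cell.re_mem ⟨_, _, _, h⟩ hy
  cases h with
  | src e =>
    cases k <;> simp [StarAt]
    · grind
  | tgt e =>
    cases k <;> simp [StarAt]
    · norm_num; tauto
  | tri t i =>
    cases k with
    | vert v =>
      refine (polyStarVert_side (M := triModel) (K.tri_closed t) i h01.1 h01.2 v m).trans ?_
      simp only [StarAt, triModel]
      constructor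
      · rintro (⟨a, b, c⟩ | ⟨a, b, c⟩)
        · exact ⟨0, by simp [c], .inl ⟨a, b, rfl⟩⟩
        · exact ⟨1, by simp [c], .inr ⟨a, b, rfl⟩⟩
      · rintro ⟨m', hm, (⟨a, b, rfl⟩ | ⟨a, b, rfl⟩)⟩
        · exact .inl ⟨a, b, by simp [hm]⟩
        · exact .inr ⟨a, b, by simp [hm]⟩
    | edge e =>
      refine (polyStarEdge_side (M := triModel) i h01.1 h01.2 e m).trans ?_
      simp only [StarAt, triModel]
      constructor
      · rintro ⟨a, b, c⟩
        exact ⟨0, by simp [c], a, b, rfl⟩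
      · rintro ⟨m', hm, a, b, rfl⟩
        exact ⟨a, b, by simp [hm]⟩
    | tri t' =>
      have := not_inside_side (M := triModel) i (K.triSide t i).2 y.re
      simp only [StarAt, and_false, exists_false, iff_false]
      exact fun h => this h.2.1
    | loz t' => simp [StarAt]
  | loz t i =>
    cases k with
    | vert v =>
      refine (polyStarVert_side (M := lozModel) (K.loz_closed t) i h01.1 h01.2 v m).trans ?_
      simp only [StarAt, lozModel]
      constructor
      · rintro (⟨a, b, c⟩ | ⟨a, b, c⟩)
        · exact ⟨0, by simp [c], .inl ⟨a, b, rfl⟩⟩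
        · exact ⟨1, by simp [c], .inr ⟨a, b, rfl⟩⟩
      · rintro ⟨m', hm, (⟨a, b, rfl⟩ | ⟨a, b, rfl⟩)⟩
        · exact .inl ⟨a, b, by simp [hm]⟩
        · exact .inr ⟨a, b, by simp [hm]⟩
    | edge e =>
      refine (polyStarEdge_side (M := lozModel) i h01.1 h01.2 e m).trans ?_
      simp only [StarAt, lozModel]
      constructor
      · rintro ⟨a, b, c⟩
        exact ⟨0, by simp [c], a, b, rfl⟩
      · rintro ⟨m', hm, a, b, rfl⟩
        exact ⟨a, b, by simp [hm]⟩
    | tri t' => simp [StarAt]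
    | loz t' =>
      have := not_inside_side (M := lozModel) i (K.lozSide t i).2 y.re
      simp only [StarAt, and_false, exists_false, iff_false]
      exact fun h => this h.2.1

/-- A point of a polygon that is not interior has a vanishing height. If a neighbouring height
vanishes too it is near a corner, otherwise near a side. -/
theorem exists_starAt (d : K.Cell) {z : ℂ} (hz : z ∈ d.shape) : ∃ c m, StarAt d z c m := by
  cases d with
  | vert v => exact ⟨.vert v, 0, rfl, rfl⟩
  | edge e =>
    obtain ⟨-, h0, h1⟩ := mem_edgeShape.1 hz
    rcases h0.lt_or_eq with h0 | h0
    · rcases h1.lt_or_eq with h1 | h1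
      · exact ⟨.edge e, 0, rfl, ⟨h0, h1⟩, rfl⟩
      · exact ⟨.vert (K.tgt e), 1, .inr ⟨by rw [h1]; norm_num, rfl, rfl⟩⟩
    · exact ⟨.vert (K.src e), 0, .inl ⟨by rw [← h0]; norm_num, rfl, rfl⟩⟩
  | tri t =>
    rcases triModel.covered z (triModel.height_nonneg hz) with h | ⟨i, h⟩ | ⟨i, h⟩
    · exact ⟨.tri t, 0, rfl, h, rfl⟩
    · exact ⟨.vert _, _, i, h, rfl, rfl⟩
    · exact ⟨.edge _, _, i, h, rfl, rfl⟩
  | loz t =>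
    rcases lozModel.covered z (lozModel.height_nonneg hz) with h | ⟨i, h⟩ | ⟨i, h⟩
    · exact ⟨.loz t, 0, rfl, h, rfl⟩
    · exact ⟨.vert _, _, i, h, rfl, rfl⟩
    · exact ⟨.edge _, _, i, h, rfl, rfl⟩

theorem isOpen_starAt (d c : K.Cell) (m : ℂ) : IsOpen {z | StarAt d z c m} := by
  have hV : ∀ {n : ℕ} [NeZero n] (M : PolyModel n) (side : Fin n → K.Edge × Bool) (v : K.Vert),
      IsOpen {z | PolyStarVert M side z v m} := by
    intro n _ M side v
    simp only [PolyStarVert, Set.ofPred_exists]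
    exact isOpen_iUnion fun i => (M.isOpen_nearCorner i).inter isOpen_const
  have hE : ∀ {n : ℕ} [NeZero n] (M : PolyModel n) (side : Fin n → K.Edge × Bool) (e : K.Edge),
      IsOpen {z | PolyStarEdge M side z e m} := by
    intro n _ M side v
    simp only [PolyStarEdge, Set.ofPred_exists]
    exact isOpen_iUnion fun i => (M.isOpen_nearSide i).inter isOpen_const
  have h1 : ∀ a : ℝ, IsOpen {z : ℂ | z.re < a} := fun a =>
    isOpen_lt Complex.continuous_re continuous_const
  have h2 : ∀ a : ℝ, IsOpen {z : ℂ | a < z.re} := fun a =>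
    isOpen_lt continuous_const Complex.continuous_re
  cases d <;> cases c <;> simp only [StarAt] <;> first
    | exact isOpen_const
    | exact hV _ _ _
    | exact hE _ _ _
    | exact isOpen_const.inter (triModel.isOpen_inside.inter isOpen_const)
    | exact isOpen_const.inter (lozModel.isOpen_inside.inter isOpen_const)
    | exact ((h1 _).inter isOpen_const).union ((h2 _).inter isOpen_const)
    | exact isOpen_const.inter (((h2 _).inter (h1 _)).inter isOpen_const)

theorem StarAt.mem {d c : K.Cell} {z m : ℂ} (h : StarAt d z c m) : m ∈ d.shape := by
  cases d <;> cases c <;> simp only [StarAt] at h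
  · exact h.2
  · rcases h with ⟨-, -, rfl⟩ | ⟨-, -, rfl⟩
    · exact left_mem_segment ℝ _ _
    · exact right_mem_segment ℝ _ _
  · obtain ⟨-, -, rfl⟩ := h
    exact left_mem_segment ℝ _ _
  · obtain ⟨i, -, -, rfl⟩ := h
    exact triModel.corner_mem i
  · obtain ⟨i, -, -, rfl⟩ := h
    exact triModel.corner_mem _
  · obtain ⟨-, -, rfl⟩ := h
    exact triModel.corner_mem 0
  · obtain ⟨i, -, -, rfl⟩ := h
    exact lozModel.corner_mem i
  · obtain ⟨i, -, -, rfl⟩ := h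
    exact lozModel.corner_mem _
  · obtain ⟨-, -, rfl⟩ := h
    exact lozModel.corner_mem 0

/-- The dimension of a cell. -/
def Cell.dim : K.Cell → ℕ
  | .vert _ => 0
  | .edge _ => 1
  | .tri _ => 2
  | .loz _ => 2

/-- The regions near different corners, or near different sides, of one polygon are disjoint. This
separates the sheets of the covering and makes the target of the contraction well defined; stars of
cells of different dimensions do overlap. -/
theorem StarAt.unique {d c c' : K.Cell} {z m m' : ℂ} (hz : z ∈ d.shape) (h : StarAt d z c m)
    (h' : StarAt d z c' m') (hc : c.dim = c'.dim) : c = c' ∧ m = m' := by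
  cases d <;> cases c <;> cases c' <;> simp only [StarAt, Cell.dim] at h h' hc <;>
    first | (exfalso; omega) | skip
  · grind
  · grind
  · grind
  · obtain ⟨i, hi, rfl, rfl⟩ := h
    obtain ⟨j, hj, rfl, rfl⟩ := h'
    obtain rfl := triModel.nearCorner_unique i j z (triModel.height_nonneg hz) hi hj
    exact ⟨rfl, rfl⟩
  · obtain ⟨i, hi, rfl, rfl⟩ := h
    obtain ⟨j, hj, rfl, rfl⟩ := h'
    obtain rfl := triModel.nearSide_unique i j z hi hj
    exact ⟨rfl, rfl⟩
  · grind
  · obtain ⟨i, hi, rfl, rfl⟩ := h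
    obtain ⟨j, hj, rfl, rfl⟩ := h'
    obtain rfl := lozModel.nearCorner_unique i j z (lozModel.height_nonneg hz) hi hj
    exact ⟨rfl, rfl⟩
  · obtain ⟨i, hi, rfl, rfl⟩ := h
    obtain ⟨j, hj, rfl, rfl⟩ := h'
    obtain rfl := lozModel.nearSide_unique i j z hi hj
    exact ⟨rfl, rfl⟩
  · grind

/-- The point of the realization given by a vertex. -/
def vertexPoint (v : K.Vert) : K.Realization := charMap (.vert v) ⟨0, rfl⟩

/-- The corners of a triangle are glued to the corresponding vertices. -/
theorem charMap_triCorner (t : K.Tri) (i : Fin 3) :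
    charMap (.tri t) ⟨triCorner i, triModel.corner_mem i⟩ =
      vertexPoint (K.start (K.triSide t i)) := by
  have h := IsFacet.tri t i
  cases hb : (K.triSide t i).2 <;> rw [hb] at h <;> simp only [cond_true, cond_false] at h
  · rw [start, hb, cond_false]
    exact (h.charMap_eq _ (right_mem_segment ℝ (0 : ℂ) 1) (by simp)).trans
      ((IsFacet.tgt _).charMap_eq (x := 1) (y := 0) _ _ (by simp))
  · rw [start, hb, cond_true]
    exact (h.charMap_eq _ (left_mem_segment ℝ (0 : ℂ) 1) (by simp)).trans
      ((IsFacet.src _).charMap_eq (x := 0) (y := 0) _ _ (by simp))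

/-- The corners of a lozenge are glued to the corresponding vertices. -/
theorem charMap_lozCorner (t : K.Loz) (i : Fin 4) :
    charMap (.loz t) ⟨lozCorner i, lozModel.corner_mem i⟩ =
      vertexPoint (K.start (K.lozSide t i)) := by
  have h := IsFacet.loz t i
  cases hb : (K.lozSide t i).2 <;> rw [hb] at h <;> simp only [cond_true, cond_false] at h
  · rw [start, hb, cond_false]
    exact (h.charMap_eq _ (right_mem_segment ℝ (0 : ℂ) 1) (by simp)).trans
      ((IsFacet.tgt _).charMap_eq (x := 1) (y := 0) _ _ (by simp))
  · rw [start, hb, cond_true]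
    exact (h.charMap_eq _ (left_mem_segment ℝ (0 : ℂ) 1) (by simp)).trans
      ((IsFacet.src _).charMap_eq (x := 0) (y := 0) _ _ (by simp))

/-- All points to which the star of a cell is contracted represent the same point. -/
theorem StarAt.charMap_eq {d c : K.Cell} {z m : ℂ} (h : StarAt d z c m) :
    charMap d ⟨m, h.mem⟩ = charMap c ⟨0, c.zero_mem⟩ := by
  have h' := h
  cases d <;> cases c <;> simp only [StarAt] at h
  · obtain ⟨rfl, rfl⟩ := h
    rfl
  · rcases h with ⟨-, rfl, rfl⟩ | ⟨-, rfl, rfl⟩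
    · exact (IsFacet.src _).charMap_eq _ _ (by simp)
    · exact (IsFacet.tgt _).charMap_eq _ _ (by simp)
  · obtain ⟨rfl, -, rfl⟩ := h
    rfl
  · obtain ⟨i, -, rfl, rfl⟩ := h
    exact charMap_triCorner _ i
  · obtain ⟨i, -, rfl, rfl⟩ := h
    exact (IsFacet.tri _ i).charMap_eq _ _ (by simp [triModel])
  · obtain ⟨rfl, -, rfl⟩ := h
    rfl
  · obtain ⟨i, -, rfl, rfl⟩ := h
    exact charMap_lozCorner _ i
  · obtain ⟨i, -, rfl, rfl⟩ := h
    exact (IsFacet.loz _ i).charMap_eq _ _ (by simp [lozModel])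
  · obtain ⟨rfl, -, rfl⟩ := h
    rfl

end LozengeComplex

/-! ### Covering maps between quotient spaces -/

/-- A criterion for a map of quotient spaces to be a covering. The sets `{a | S a c}` and
`{b | T b d}` are the (saturated, open) stars upstairs and downstairs. -/
theorem isCoveringMap_quotMap {A B C D : Type*} [TopologicalSpace A] [TopologicalSpace B]
    [Nonempty A] {r : A → A → Prop} {r' : B → B → Prop} {Φ : A → B} (hΦ : Continuous Φ)
    (hΦo : IsOpenMap Φ) (hom : ∀ a a', r a a' → r' (Φ a) (Φ a')) {f : C → D}
    (hf : Function.Surjective f) {S : A → C → Prop} {T : B → D → Prop}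
    (hSo : ∀ c, IsOpen {a | S a c}) (hTo : ∀ d, IsOpen {b | T b d})
    (hSr : ∀ a a' c, r a a' → (S a c ↔ S a' c)) (hTr : ∀ b b' d, r' b b' → (T b d ↔ T b' d))
    (cover : ∀ b, ∃ d, T b d) (hST : ∀ a d, T (Φ a) d → ∃ c, f c = d ∧ S a c)
    (hTS : ∀ a c, S a c → T (Φ a) (f c))
    (uniq : ∀ a c c', S a c → S a c' → f c = f c' → c = c')
    (lift : ∀ b c, T b (f c) → ∃ a, Φ a = b ∧ S a c)
    (lift_unique : ∀ a a' c, Φ a = Φ a' → S a c → S a' c → a = a')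
    (down : ∀ a b', r' (Φ a) b' → ∃ a', r a a' ∧ Φ a' = b') :
    IsCoveringMap (Quot.map Φ hom) := by
  classical
  have hmk : ∀ (c : C) (a : A), S a c ↔ Quot.lift (fun a => S a c)
    (fun a a' h => propext (hSr a a' c h)) (Quot.mk r a) := fun _ _ => Iff.rfl
  have hmk' : ∀ (d : D) (b : B), T b d ↔ Quot.lift (fun b => T b d)
    (fun b b' h => propext (hTr b b' d h)) (Quot.mk r' b) := fun _ _ => Iff.rfl
  set U : C → Set (Quot r) := fun c => {x | Quot.lift (fun a => S a c)
    (fun a a' h => propext (hSr a a' c h)) x} with hU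
  set V : D → Set (Quot r') := fun d => {y | Quot.lift (fun b => T b d)
    (fun b b' h => propext (hTr b b' d h)) y} with hV
  have memU : ∀ a c, Quot.mk r a ∈ U c ↔ S a c := fun _ _ => Iff.rfl
  have memV : ∀ b d, Quot.mk r' b ∈ V d ↔ T b d := fun _ _ => Iff.rfl
  have openU : ∀ c, IsOpen (U c) := fun c => isQuotientMap_quot_mk.isOpen_preimage.1 (hSo c)
  have openV : ∀ d, IsOpen (V d) := fun d => isQuotientMap_quot_mk.isOpen_preimage.1 (hTo d)
  have hcont : Continuous (Quot.map Φ hom) :=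
    continuous_quot_lift _ (continuous_quot_mk.comp hΦ)
  -- Injectivity on the star of `c`: a chain of gluings downstairs stays in the star of `f c`, and
  -- each point of it has a unique lift in the star of `c`. Consecutive lifts are glued, by `down`
  -- and `lift_unique`.
  have inj : ∀ c b b', Relation.EqvGen r' b b' → (T b (f c) ↔ T b' (f c)) ∧
      (T b (f c) → ∀ a a', Φ a = b → Φ a' = b' → S a c → S a' c → Quot.mk r a = Quot.mk r a') := by
    intro c b b' h
    induction h with
    | rel b b' h =>
      refine ⟨hTr _ _ _ h, fun _ a a' ha ha' hS hS' => ?_⟩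
      subst ha
      obtain ⟨a'', h1, h2⟩ := down a b' h
      have : a'' = a' := lift_unique _ _ c (h2.trans ha'.symm) ((hSr _ _ _ h1).1 hS) hS'
      exact this ▸ Quot.sound h1
    | refl b =>
      refine ⟨Iff.rfl, fun _ a a' ha ha' hS hS' => ?_⟩
      rw [lift_unique a a' c (ha.trans ha'.symm) hS hS']
    | symm b b' _ ih =>
      exact ⟨ih.1.symm, fun h a a' ha ha' hS hS' => (ih.2 (ih.1.2 h) a' a ha' ha hS' hS).symm⟩
    | trans b b' b'' _ _ ih ih' =>
      refine ⟨ih.1.trans ih'.1, fun h a a' ha ha' hS hS' => ?_⟩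
      obtain ⟨x, hx, hxS⟩ := lift b' c (ih.1.1 h)
      exact (ih.2 h a x ha hx hS hxS).trans (ih'.2 (ih.1.1 h) x a' hx ha' hxS hS')
  choose g hg using fun y : Quot r' => (Quot.exists_rep y)
  choose d hd using fun y : Quot r' => cover (g y)
  have hyV : ∀ y, y ∈ V (d y) := fun y => by
    have := (memV (g y) (d y)).2 (hd y)
    rwa [hg y] at this
  -- The sheets over the star of `d` are indexed by the cells above `d`, as a discrete space.
  let _ : ∀ d, TopologicalSpace {c // f c = d} := fun _ => ⊥
  have _ : ∀ d, DiscreteTopology {c // f c = d} := fun _ => ⟨rfl⟩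
  have key : ∀ d, ∃ t : Bundle.Trivialization {c // f c = d} (Quot.map Φ hom), t.baseSet = V d := by
    intro d
    obtain ⟨c₀, hc₀⟩ := hf d
    have : Nonempty {c // f c = d} := ⟨⟨c₀, hc₀⟩⟩
    have : Nonempty (Quot r' → Quot r) := ⟨fun _ => Quot.mk r (Classical.arbitrary A)⟩
    refine ⟨IsOpen.trivializationDiscrete (fun c : {c // f c = d} => U c) (V d) (openV d)
      ?_ ?_ ?_ ?_ ?_, rfl⟩
    · rintro ⟨c, rfl⟩ W hW
      refine ⟨fun h => (h.preimage hcont).inter (openU c), fun h => ?_⟩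
      rw [← isQuotientMap_quot_mk.isOpen_preimage]
      -- As every point of the star of `f c` lifts to the star of `c`, the preimage of `W` in `B` is
      -- the `Φ`-image of an open subset of `A`.
      convert! hΦo _ (h.preimage continuous_quot_mk) using 1
      ext b
      constructor
      · intro hb
        obtain ⟨a, rfl, ha⟩ := lift b c ((memV _ _).1 (hW hb))
        exact ⟨a, ⟨hb, (memU _ _).2 ha⟩, rfl⟩
      · rintro ⟨a, ⟨ha, -⟩, rfl⟩
        exact ha
    · rintro ⟨c, rfl⟩ x hx x' hx' h
      induction x using Quot.ind with | mk a
      induction x' using Quot.ind with | mk a'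
      exact (inj c _ _ (Quot.eqvGen_exact h)).2 (hTS a c hx) a a' rfl rfl hx hx'
    · rintro ⟨c, rfl⟩ y hy
      induction y using Quot.ind with | mk b
      obtain ⟨a, rfl, ha⟩ := lift b c hy
      exact ⟨Quot.mk r a, ha, rfl⟩
    · rintro ⟨c, rfl⟩ ⟨c', hc'⟩ hne
      refine Set.disjoint_left.2 fun x hx hx' => hne ?_
      induction x using Quot.ind with | mk a
      exact Subtype.ext (uniq a c c' hx hx' hc'.symm)
    · intro x hx
      induction x using Quot.ind with | mk a
      obtain ⟨c, hc, ha⟩ := hST a d hx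
      exact Set.mem_iUnion.2 ⟨⟨c, hc⟩, ha⟩
  choose t ht using key
  exact IsCoveringMap.mk _ (fun y => {c // f c = d y}) (fun y => t (d y))
    fun y => (ht (d y)).symm ▸ hyV y

namespace LozengeComplex

/-! ### Morphisms of complexes -/

/-- A map between the `1`-skeletons of two complexes. The edge `e` is mapped to `edge e`, reversing
its orientation if `flip e` is true. -/
structure EdgeMap (K L : LozengeComplex) where
  vert : K.Vert → L.Vert
  edge : K.Edge → L.Edge
  flip : K.Edge → Bool
  start_edge : ∀ s : K.Edge × Bool, L.start (edge s.1, flip s.1 ^^ s.2) = vert (K.start s)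

/-- A map between faces, compatible with a map between the `1`-skeletons. -/
structure FaceMap {K L : LozengeComplex} (f : EdgeMap K L) {n : ℕ} [NeZero n] (M : PolyModel n)
    {T T' : Type} (sK : T → Fin n → K.Edge × Bool) (sL : T' → Fin n → L.Edge × Bool) where
  map : T → T'
  sym : T → PolySym M
  side_map : ∀ t i, sL (map t) ((sym t).side i) =
    (f.edge (sK t i).1, (sym t).refl ^^ (f.flip (sK t i).1 ^^ (sK t i).2))

/-- A morphism of complexes. -/
structure Hom (K L : LozengeComplex) extends EdgeMap K L where
  tri : FaceMap toEdgeMap triModel K.triSide L.triSide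
  loz : FaceMap toEdgeMap lozModel K.lozSide L.lozSide

variable {K L : LozengeComplex}

theorem finish_eq_start (s : K.Edge × Bool) : K.finish s = K.start (s.1, !s.2) := by
  obtain ⟨e, b⟩ := s
  cases b <;> rfl

/-- Every end of an edge at the image of `v` lifts uniquely to an end of an edge at `v`. -/
structure EdgeMap.IsCovering (f : EdgeMap K L) : Prop where
  lift : ∀ v e' b, L.start (e', b) = f.vert v → ∃ e, f.edge e = e' ∧ K.start (e, f.flip e ^^ b) = v
  unique : ∀ e₁ e₂ b, f.edge e₁ = f.edge e₂ →
    K.start (e₁, f.flip e₁ ^^ b) = K.start (e₂, f.flip e₂ ^^ b) → e₁ = e₂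

/-! ### Lifting faces along edges and around vertices -/

section FaceMap

variable {f : EdgeMap K L} {n : ℕ} [NeZero n] {M : PolyModel n} {T T' : Type}
  {sK : T → Fin n → K.Edge × Bool} {sL : T' → Fin n → L.Edge × Bool}

/-- Every face at the image of `e` lifts uniquely to a face at `e`. -/
structure FaceMap.IsCovering (F : FaceMap f M sK sL) : Prop where
  lift : ∀ e t' j, (sL t' j).1 = f.edge e →
    ∃ t i, F.map t = t' ∧ (F.sym t).side i = j ∧ (sK t i).1 = e
  unique : ∀ t₁ i₁ t₂ i₂, F.map t₁ = F.map t₂ → (F.sym t₁).side i₁ = (F.sym t₂).side i₂ →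
    (sK t₁ i₁).1 = (sK t₂ i₂).1 → t₁ = t₂

namespace FaceMap

variable (F : FaceMap f M sK sL)

/-- A reflection carries corner `i` to the end of the image of side `i`. Closedness of the boundary
turns this end into the start of the following side. -/
theorem start_cornerMap (hL : ∀ t i, L.start (sL t (i + 1)) = L.finish (sL t i)) (t : T)
    (i : Fin n) :
    L.start (sL (F.map t) ((F.sym t).cornerMap i)) = f.vert (K.start (sK t i)) := by
  have h := F.side_map t i
  rw [← f.start_edge]
  cases hr : (F.sym t).refl
  · rw [show (F.sym t).cornerMap i = (F.sym t).side i by simp [PolySym.cornerMap, PolySym.side, hr],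
      h, hr, Bool.false_xor]
  · rw [show (F.sym t).cornerMap i = (F.sym t).side i + 1 by
      simp [PolySym.cornerMap, PolySym.side, hr], hL, h, hr, finish_eq_start]
    simp

theorem starVert_iff (hL : ∀ t i, L.start (sL t (i + 1)) = L.finish (sL t i)) (t : T) (z : ℂ)
    (v' : L.Vert) :
    (∃ m, PolyStarVert M (sL (F.map t)) ((F.sym t).toFun z) v' m) ↔
      ∃ v, f.vert v = v' ∧ ∃ m, PolyStarVert M (sK t) z v m := by
  constructor
  · rintro ⟨_, j, hj, rfl, -⟩
    obtain ⟨i, rfl⟩ := (F.sym t).cornerMap_surjective j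
    exact ⟨_, (F.start_cornerMap hL t i).symm, _, i, (F.sym t).nearCorner_toFun.1 hj, rfl, rfl⟩
  · rintro ⟨_, rfl, _, i, hi, rfl, -⟩
    exact ⟨_, _, (F.sym t).nearCorner_toFun.2 hi, F.start_cornerMap hL t i, rfl⟩

theorem starEdge_iff (t : T) (z : ℂ) (e' : L.Edge) :
    (∃ m, PolyStarEdge M (sL (F.map t)) ((F.sym t).toFun z) e' m) ↔
      ∃ e, f.edge e = e' ∧ ∃ m, PolyStarEdge M (sK t) z e m := by
  constructor
  · rintro ⟨_, j, hj, rfl, -⟩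
    rw [← (F.sym t).side_sideInv j] at hj ⊢
    refine ⟨_, ?_, _, _, (F.sym t).nearSide_toFun.1 hj, rfl, rfl⟩
    rw [F.side_map]
  · rintro ⟨_, rfl, _, i, hi, rfl, -⟩
    refine ⟨_, _, (F.sym t).nearSide_toFun.2 hi, ?_, rfl⟩
    rw [F.side_map]

/-- The side which is mapped onto the side starting at the image of corner `i`. -/
theorem exists_side_eq_cornerMap (hK : ∀ t i, K.start (sK t (i + 1)) = K.finish (sK t i))
    (t : T) (j : Fin n) : ∃ i i', (F.sym t).cornerMap i = j ∧ (F.sym t).side i' = j ∧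
      K.start (sK t i) = K.start ((sK t i').1, f.flip (sK t i').1 ^^ (sL (F.map t) j).2) := by
  obtain ⟨i', hi'⟩ : ∃ i', (F.sym t).side i' = j := ⟨_, (F.sym t).side_sideInv j⟩
  subst hi'
  rw [F.side_map]
  cases hr : (F.sym t).refl
  · refine ⟨i', i', by simp [PolySym.cornerMap, PolySym.side, hr], rfl, ?_⟩
    simp
  · refine ⟨i' + 1, i', ?_, rfl, ?_⟩
    · simp only [PolySym.cornerMap, PolySym.side, hr, cond_true]; abel
    · rw [hK, finish_eq_start]
      simp

theorem cornerMap_injective (D : PolySym M) : Function.Injective D.cornerMap :=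
  Finite.injective_iff_surjective.2 D.cornerMap_surjective

variable {F}

/-- The side leaving the corner lifts to an edge end at `v`, and the face then lifts along that
edge. Hence conditions at edges suffice to lift faces at vertices. -/
theorem IsCovering.exists_corner (hF : F.IsCovering) (hf : f.IsCovering)
    (hK : ∀ t i, K.start (sK t (i + 1)) = K.finish (sK t i)) {v : K.Vert} {t' : T'} {j : Fin n}
    (h : L.start (sL t' j) = f.vert v) :
    ∃ t i, F.map t = t' ∧ (F.sym t).cornerMap i = j ∧ K.start (sK t i) = v := by
  obtain ⟨e, he, hev⟩ := hf.lift v _ _ h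
  obtain ⟨t, i, rfl, hi, rfl⟩ := hF.lift e t' j he.symm
  obtain ⟨i₁, i₂, h1, h2, h3⟩ := F.exists_side_eq_cornerMap hK t j
  refine ⟨t, i₁, rfl, h1, ?_⟩
  have : i₂ = i := by
    rw [← (F.sym t).sideInv_side i₂, h2, ← hi, PolySym.sideInv_side]
  rw [h3, this]
  exact hev

/-- The sides lying over the one that leaves the common image corner start at the same vertex, so
they coincide by uniqueness for edges, and uniqueness of faces along an edge applies. -/
theorem IsCovering.corner_unique (hF : F.IsCovering) (hf : f.IsCovering)
    (hK : ∀ t i, K.start (sK t (i + 1)) = K.finish (sK t i)) {t₁ t₂ : T} {i₁ i₂ : Fin n}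
    (ht : F.map t₁ = F.map t₂) (hi : (F.sym t₁).cornerMap i₁ = (F.sym t₂).cornerMap i₂)
    (hv : K.start (sK t₁ i₁) = K.start (sK t₂ i₂)) : t₁ = t₂ := by
  obtain ⟨a₁, b₁, h1, h2, h3⟩ := F.exists_side_eq_cornerMap hK t₁ ((F.sym t₁).cornerMap i₁)
  obtain ⟨a₂, b₂, k1, k2, k3⟩ := F.exists_side_eq_cornerMap hK t₂ ((F.sym t₂).cornerMap i₂)
  obtain rfl := cornerMap_injective _ h1
  obtain rfl := cornerMap_injective _ k1
  have e1 := F.side_map t₁ b₁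
  have e2 := F.side_map t₂ b₂
  rw [h2] at e1
  rw [k2] at e2
  rw [ht, hi] at e1
  have e3 := congrArg Prod.fst (e1.symm.trans e2)
  refine hF.unique t₁ b₁ t₂ b₂ ht (h2.trans (hi.trans k2.symm)) ?_
  refine hf.unique _ _ (sL (F.map t₁) ((F.sym t₁).cornerMap a₁)).2 e3 ?_
  rw [← h3, hv, k3, ht, hi]

end FaceMap

end FaceMap

/-- A morphism which is bijective on the cells around every vertex and around every edge. -/
structure Hom.IsCovering (f : Hom K L) : Prop where
  edge : f.toEdgeMap.IsCovering
  tri : f.tri.IsCovering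
  loz : f.loz.IsCovering
  vert_surjective : Function.Surjective f.vert
  tri_surjective : Function.Surjective f.tri.map
  loz_surjective : Function.Surjective f.loz.map
  edge_surjective : Function.Surjective f.edge

/-! ### The map of realizations, and why it is a covering -/

namespace Hom

variable (f : Hom K L)

/-- The action of a morphism on cells. -/
def cellMap : K.Cell → L.Cell
  | .vert v => .vert (f.vert v)
  | .edge e => .edge (f.edge e)
  | .tri t => .tri (f.tri.map t)
  | .loz l => .loz (f.loz.map l)

/-- The action of a morphism on the models of cells. -/
noncomputable def pointMap : K.Cell → ℂ → ℂ
  | .vert _, z => z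
  | .edge e, z => bif f.flip e then 1 - z else z
  | .tri t, z => (f.tri.sym t).toFun z
  | .loz l, z => (f.loz.sym l).toFun z

/-- The inverse of the action of a morphism on the models of cells. -/
noncomputable def pointInv : K.Cell → ℂ → ℂ
  | .vert _, z => z
  | .edge e, z => bif f.flip e then 1 - z else z
  | .tri t, z => (f.tri.sym t).invFun z
  | .loz l, z => (f.loz.sym l).invFun z

@[simp] theorem pointMap_pointInv (c : K.Cell) (z : ℂ) : f.pointMap c (f.pointInv c z) = z := by
  cases c with
  | vert v => rfl
  | edge e => simp only [pointMap, pointInv]; cases f.flip e <;> simp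
  | tri t => simp [pointMap, pointInv]
  | loz t => simp [pointMap, pointInv]

@[simp] theorem pointInv_pointMap (c : K.Cell) (z : ℂ) : f.pointInv c (f.pointMap c z) = z := by
  cases c with
  | vert v => rfl
  | edge e => simp only [pointMap, pointInv]; cases f.flip e <;> simp
  | tri t => simp [pointMap, pointInv]
  | loz t => simp [pointMap, pointInv]

theorem dist_pointMap (c : K.Cell) (z w : ℂ) :
    dist (f.pointMap c z) (f.pointMap c w) = dist z w := by
  cases c with
  | vert v => rfl
  | edge e =>
    simp only [pointMap]
    cases f.flip e
    · rfl
    · rw [cond_true, cond_true, Complex.dist_eq, Complex.dist_eq, ← norm_neg]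
      congr 1; ring
  | tri t => exact (f.tri.sym t).dist_toFun z w
  | loz t => exact (f.loz.sym t).dist_toFun z w

theorem pointMap_mem {c : K.Cell} {z : ℂ} (hz : z ∈ c.shape) :
    f.pointMap c z ∈ (f.cellMap c).shape := by
  cases c with
  | vert v => exact hz
  | edge e =>
    have h := mem_edgeShape.1 hz
    refine mem_edgeShape.2 ?_
    simp only [pointMap]
    cases f.flip e <;> simp [h]
  | tri t => exact (f.tri.sym t).toFun_mem hz
  | loz t => exact (f.loz.sym t).toFun_mem hz

theorem pointInv_mem {c : K.Cell} {z : ℂ} (hz : z ∈ (f.cellMap c).shape) :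
    f.pointInv c z ∈ c.shape := by
  cases c with
  | vert v => exact hz
  | edge e =>
    have h := mem_edgeShape.1 hz
    refine mem_edgeShape.2 ?_
    simp only [pointInv]
    cases f.flip e <;> simp [h]
  | tri t => exact (f.tri.sym t).invFun_mem hz
  | loz t => exact (f.loz.sym t).invFun_mem hz

/-- The isometry between the models of a cell and its image. -/
noncomputable def shapeIso (c : K.Cell) : c.shape ≃ᵢ (f.cellMap c).shape where
  toFun z := ⟨f.pointMap c z, f.pointMap_mem z.2⟩
  invFun z := ⟨f.pointInv c z, f.pointInv_mem z.2⟩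
  left_inv z := Subtype.ext (f.pointInv_pointMap c z)
  right_inv z := Subtype.ext (f.pointMap_pointInv c z)
  isometry_toFun := Isometry.of_dist_eq fun z w => f.dist_pointMap c z w

/-- The map of disjoint unions of cells given by a morphism. -/
noncomputable def preMap (a : K.PreRealization) : L.PreRealization :=
  ⟨f.cellMap a.1, f.shapeIso a.1 a.2⟩

theorem continuous_preMap : Continuous f.preMap :=
  continuous_sigma fun c => (continuous_sigmaMk (σ := fun c : L.Cell => c.shape)
      (i := f.cellMap c)).comp
    (f.shapeIso c).continuous

theorem isOpenMap_preMap : IsOpenMap f.preMap :=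
  isOpenMap_sigma.2 fun c => (isOpenMap_sigmaMk (σ := fun c : L.Cell => c.shape)
      (i := f.cellMap c)).comp
    (f.shapeIso c).toHomeomorph.isOpenMap

/-- Three independent reversals are reconciled here: that of the symmetry, that of the traversal
(`b`), and that of the edge under the morphism (`c`). The first and last combine with `b` into the
traversal of the image side, and `c` also reverses the parameter. -/
theorem toFun_side {n : ℕ} [NeZero n] {M : PolyModel n} (D : PolySym M) (i : Fin n) (b c : Bool)
    (s : ℝ) :
    D.toFun (AffineMap.lineMap (M.corner (bif b then i else i + 1))
      (M.corner (bif b then i + 1 else i)) s) =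
    AffineMap.lineMap (M.corner (bif (D.refl ^^ (c ^^ b)) then D.side i else D.side i + 1))
      (M.corner (bif (D.refl ^^ (c ^^ b)) then D.side i + 1 else D.side i))
      (bif c then 1 - s else s) := by
  have h0 : D.cornerMap i = bif D.refl then D.side i + 1 else D.side i := by
    simp only [PolySym.cornerMap, PolySym.side]; cases D.refl <;> simp
  have h1 : D.cornerMap (i + 1) = bif D.refl then D.side i else D.side i + 1 := by
    simp only [PolySym.cornerMap, PolySym.side]
    cases D.refl <;> simp only [cond_true, cond_false] <;> abel
  rw [D.toFun_lineMap]
  cases b <;> cases c <;> cases hr : D.refl <;> rw [hr] at h0 h1 <;>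
    simp only [D.toFun_corner', h0, h1, cond_true, cond_false, Bool.xor_true, Bool.xor_false,
      Bool.not_true, Bool.not_false, AffineMap.lineMap_apply_one_sub]

theorem src_edge (e : K.Edge) :
    L.src (f.edge e) = f.vert (bif f.flip e then K.tgt e else K.src e) := by
  have h := f.start_edge (e, !f.flip e)
  simp only [start, Bool.xor_not, Bool.xor_self, Bool.not_false, cond_true] at h
  rw [h]
  cases f.flip e <;> rfl

theorem tgt_edge (e : K.Edge) :
    L.tgt (f.edge e) = f.vert (bif f.flip e then K.src e else K.tgt e) := by
  have h := f.start_edge (e, f.flip e)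
  simp only [start, Bool.xor_self, cond_false] at h
  rw [h]

/-- Facets are mapped to facets. -/
theorem map_facet {c d : K.Cell} {p q : ℂ} (h : K.IsFacet c d p q) :
    ∃ p' q', L.IsFacet (f.cellMap c) (f.cellMap d) p' q' ∧ ∀ y : ℂ,
      f.pointMap c (AffineMap.lineMap p q y.re) = AffineMap.lineMap p' q' (f.pointMap d y).re := by
  cases h with
  | src e =>
    have h1 := IsFacet.src (K := L) (f.edge e)
    have h2 := IsFacet.tgt (K := L) (f.edge e)
    rw [f.src_edge] at h1
    rw [f.tgt_edge] at h2
    cases hb : f.flip e <;> rw [hb] at h1 h2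
    · exact ⟨_, _, h1, fun y => by simp [pointMap, hb]⟩
    · exact ⟨_, _, h2, fun y => by simp [pointMap, hb]⟩
  | tgt e =>
    have h1 := IsFacet.src (K := L) (f.edge e)
    have h2 := IsFacet.tgt (K := L) (f.edge e)
    rw [f.src_edge] at h1
    rw [f.tgt_edge] at h2
    cases hb : f.flip e <;> rw [hb] at h1 h2
    · exact ⟨_, _, h2, fun y => by simp [pointMap, hb]⟩
    · exact ⟨_, _, h1, fun y => by simp [pointMap, hb]⟩
  | tri t i =>
    have h := IsFacet.tri (K := L) (f.tri.map t) ((f.tri.sym t).side i)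
    rw [f.tri.side_map] at h
    refine ⟨_, _, h, fun y => (toFun_side (M := triModel) _ i _ (f.flip (K.triSide t i).1)
        y.re).trans ?_⟩
    congr 1
    simp only [pointMap]
    cases f.flip (K.triSide t i).1 <;> simp
  | loz t i =>
    have h := IsFacet.loz (K := L) (f.loz.map t) ((f.loz.sym t).side i)
    rw [f.loz.side_map] at h
    refine ⟨_, _, h, fun y => (toFun_side (M := lozModel) _ i _ (f.flip (K.lozSide t i).1)
        y.re).trans ?_⟩
    congr 1
    simp only [pointMap]
    cases f.flip (K.lozSide t i).1 <;> simp

/-- Facets of the image of a cell are the images of the facets of the cell. -/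
theorem exists_facet {c : K.Cell} {d' : L.Cell} {p' q' : ℂ} (h : L.IsFacet (f.cellMap c) d' p' q') :
    ∃ d p q, K.IsFacet c d p q ∧ f.cellMap d = d' ∧ ∀ y : ℂ,
      f.pointMap c (AffineMap.lineMap p q y.re) = AffineMap.lineMap p' q' (f.pointMap d y).re := by
  cases c with
  | vert v => cases h
  | edge e =>
    have h1 := IsFacet.src (K := K) e
    have h2 := IsFacet.tgt (K := K) e
    cases h with
    | src =>
      rw [f.src_edge]
      cases hb : f.flip e
      · exact ⟨_, _, _, h1, rfl, fun y => by simp [pointMap, hb]⟩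
      · exact ⟨_, _, _, h2, rfl, fun y => by simp [pointMap, hb]⟩
    | tgt =>
      rw [f.tgt_edge]
      cases hb : f.flip e
      · exact ⟨_, _, _, h2, rfl, fun y => by simp [pointMap, hb]⟩
      · exact ⟨_, _, _, h1, rfl, fun y => by simp [pointMap, hb]⟩
  | tri t =>
    cases h with
    | tri _ j =>
      obtain ⟨i, rfl⟩ : ∃ i, (f.tri.sym t).side i = j := ⟨_, (f.tri.sym t).side_sideInv j⟩
      rw [f.tri.side_map]
      refine ⟨_, _, _, .tri t i, rfl, fun y =>
        (toFun_side (M := triModel) _ i _ (f.flip (K.triSide t i).1) y.re).trans ?_⟩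
      congr 1
      simp only [pointMap]
      cases f.flip (K.triSide t i).1 <;> simp
  | loz t =>
    cases h with
    | loz _ j =>
      obtain ⟨i, rfl⟩ : ∃ i, (f.loz.sym t).side i = j := ⟨_, (f.loz.sym t).side_sideInv j⟩
      rw [f.loz.side_map]
      refine ⟨_, _, _, .loz t i, rfl, fun y =>
        (toFun_side (M := lozModel) _ i _ (f.flip (K.lozSide t i).1) y.re).trans ?_⟩
      congr 1
      simp only [pointMap]
      cases f.flip (K.lozSide t i).1 <;> simp

theorem glue_preMap {a a' : K.PreRealization} (h : K.Glue a a') :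
    L.Glue (f.preMap a) (f.preMap a') := by
  obtain ⟨p, q, hf, hx⟩ := glue_iff.1 h
  obtain ⟨p', q', hf', hy⟩ := f.map_facet hf
  exact glue_iff.2 ⟨p', q', hf', (congrArg (f.pointMap a.1) hx).trans (hy a'.2)⟩

/-- The continuous map of realizations given by a morphism. -/
noncomputable def realization : K.Realization → L.Realization :=
  Quot.map f.preMap fun _ _ h => f.glue_preMap h

theorem isCellwiseIsometric_realization : IsCellwiseIsometric f.realization :=
  fun c => ⟨f.cellMap c, f.shapeIso c, fun _ => rfl⟩

/-- The point `z` of the model of the cell `d` lies in the open star of the cell `c`. -/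
def _root_.LozengeComplex.InStar (d : K.Cell) (z : ℂ) (c : K.Cell) : Prop := ∃ m, StarAt d z c m

/-- The symmetries permute the regions near corners and sides, compatibly with the attached vertices
and edges. So the preimage of a star is the union of the stars of the cells above, with no covering
hypothesis. -/
theorem inStar_pointMap_iff (d : K.Cell) (z : ℂ) (c' : L.Cell) :
    InStar (f.cellMap d) (f.pointMap d z) c' ↔ ∃ c, f.cellMap c = c' ∧ InStar d z c := by
  cases d with
  | vert v =>
    constructor
    · rintro ⟨m, h⟩
      cases c' <;> simp only [cellMap, StarAt] at h
      obtain ⟨rfl, rfl⟩ := h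
      exact ⟨.vert v, rfl, 0, rfl, rfl⟩
    · rintro ⟨c, rfl, m, h⟩
      cases c <;> simp only [StarAt] at h
      obtain ⟨rfl, rfl⟩ := h
      exact ⟨0, rfl, rfl⟩
  | edge e =>
    have h1 := f.src_edge e
    have h2 := f.tgt_edge e
    constructor
    · rintro ⟨m, h⟩
      cases c' with
      | vert v' =>
        simp only [cellMap, StarAt, pointMap] at h
        rw [h1, h2] at h
        cases hb : f.flip e <;> rw [hb] at h <;> simp only [cond_true, cond_false] at h
        · rcases h with ⟨h, rfl, -⟩ | ⟨h, rfl, -⟩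
          · exact ⟨.vert _, rfl, _, .inl ⟨h, rfl, rfl⟩⟩
          · exact ⟨.vert _, rfl, _, .inr ⟨h, rfl, rfl⟩⟩
        · rw [Complex.sub_re, Complex.one_re] at h
          rcases h with ⟨h, rfl, -⟩ | ⟨h, rfl, -⟩
          · exact ⟨.vert _, rfl, _, .inr ⟨by linarith, rfl, rfl⟩⟩
          · exact ⟨.vert _, rfl, _, .inl ⟨by linarith, rfl, rfl⟩⟩
      | edge e' =>
        simp only [cellMap, StarAt, pointMap] at h
        obtain ⟨rfl, h, rfl⟩ := h
        refine ⟨.edge e, rfl, 0, rfl, ?_, rfl⟩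
        cases hb : f.flip e <;> rw [hb] at h
        · exact h
        · rw [cond_true, Complex.sub_re, Complex.one_re] at h
          constructor <;> linarith
      | tri t => exact h.elim
      | loz l => exact h.elim
    · rintro ⟨c, rfl, m, h⟩
      cases c with
      | vert v =>
        simp only [StarAt] at h
        simp only [InStar, cellMap, StarAt, pointMap]
        rw [h1, h2]
        cases hb : f.flip e <;> simp only [cond_true, cond_false]
        · rcases h with ⟨h, rfl, -⟩ | ⟨h, rfl, -⟩
          · exact ⟨_, .inl ⟨h, rfl, rfl⟩⟩
          · exact ⟨_, .inr ⟨h, rfl, rfl⟩⟩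
        · rw [Complex.sub_re, Complex.one_re]
          rcases h with ⟨h, rfl, -⟩ | ⟨h, rfl, -⟩
          · exact ⟨_, .inr ⟨by linarith, rfl, rfl⟩⟩
          · exact ⟨_, .inl ⟨by linarith, rfl, rfl⟩⟩
      | edge e' =>
        obtain ⟨rfl, h, -⟩ := h
        refine ⟨0, rfl, ?_, rfl⟩
        simp only [pointMap]
        cases f.flip e
        · exact h
        · rw [cond_true, Complex.sub_re, Complex.one_re]
          constructor <;> linarith
      | tri t => exact h.elim
      | loz l => exact h.elim
  | tri t =>
    have hV := f.tri.starVert_iff L.tri_closed t z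
    have hE := f.tri.starEdge_iff t z
    constructor
    · rintro ⟨m, h⟩
      cases c' <;> simp only [cellMap, StarAt] at h
      · obtain ⟨v, rfl, m, h⟩ := (hV _).1 ⟨m, h⟩
        exact ⟨.vert v, rfl, m, h⟩
      · obtain ⟨e, rfl, m, h⟩ := (hE _).1 ⟨m, h⟩
        exact ⟨.edge e, rfl, m, h⟩
      · obtain ⟨rfl, h, -⟩ := h
        exact ⟨.tri t, rfl, 0, rfl, (f.tri.sym t).inside_toFun.1 h, rfl⟩
    · rintro ⟨c, rfl, m, h⟩
      cases c <;> simp only [StarAt] at h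
      · exact (hV _).2 ⟨_, rfl, m, h⟩
      · exact (hE _).2 ⟨_, rfl, m, h⟩
      · obtain ⟨rfl, h, -⟩ := h
        exact ⟨0, rfl, (f.tri.sym t).inside_toFun.2 h, rfl⟩
  | loz t =>
    have hV := f.loz.starVert_iff L.loz_closed t z
    have hE := f.loz.starEdge_iff t z
    constructor
    · rintro ⟨m, h⟩
      cases c' <;> simp only [cellMap, StarAt] at h
      · obtain ⟨v, rfl, m, h⟩ := (hV _).1 ⟨m, h⟩
        exact ⟨.vert v, rfl, m, h⟩
      · obtain ⟨e, rfl, m, h⟩ := (hE _).1 ⟨m, h⟩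
        exact ⟨.edge e, rfl, m, h⟩
      · obtain ⟨rfl, h, -⟩ := h
        exact ⟨.loz t, rfl, 0, rfl, (f.loz.sym t).inside_toFun.1 h, rfl⟩
    · rintro ⟨c, rfl, m, h⟩
      cases c <;> simp only [StarAt] at h
      · exact (hV _).2 ⟨_, rfl, m, h⟩
      · exact (hE _).2 ⟨_, rfl, m, h⟩
      · obtain ⟨rfl, h, -⟩ := h
        exact ⟨0, rfl, (f.loz.sym t).inside_toFun.2 h, rfl⟩

variable {f}

/-- Together with `IsCovering.lift_unique` this makes the star of `c` biject, before gluing, with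
the star of its image. A point near a corner lifts by `exists_corner`, a point near a side by the
lifting of faces along edges. -/
theorem IsCovering.exists_lift (hf : f.IsCovering) {d' : L.Cell} {z' : ℂ} {c : K.Cell}
    (h : InStar d' z' (f.cellMap c)) :
    ∃ d z, f.cellMap d = d' ∧ f.pointMap d z = z' ∧ InStar d z c := by
  obtain ⟨m, h⟩ := h
  cases c with
  | vert v =>
    cases d' with
    | vert w =>
      obtain ⟨rfl, rfl⟩ := h
      exact ⟨.vert v, z', rfl, rfl, 0, rfl, rfl⟩
    | edge e' =>
      have key : ∃ b, L.start (e', b) = f.vert v ∧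
          (bif b then z'.re < 1 / 2 else 1 / 2 < z'.re) := by
        rcases h with ⟨h, hv, -⟩ | ⟨h, hv, -⟩
        · exact ⟨true, hv, h⟩
        · exact ⟨false, hv, h⟩
      obtain ⟨b, hb, hz⟩ := key
      obtain ⟨e, rfl, rfl⟩ := hf.edge.lift v e' b hb
      refine ⟨.edge e, f.pointInv (.edge e) z', rfl, by simp, ?_⟩
      simp only [InStar, StarAt, pointInv, start]
      cases f.flip e <;> cases b <;> simp only [cond_true, cond_false, Bool.xor_true,
        Bool.xor_false, Bool.not_true, Bool.not_false, Complex.sub_re, Complex.one_re] at hz ⊢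
      · exact ⟨_, .inr ⟨hz, trivial, rfl⟩⟩
      · exact ⟨_, .inl ⟨hz, trivial, rfl⟩⟩
      · exact ⟨_, .inl ⟨by linarith, trivial, rfl⟩⟩
      · exact ⟨_, .inr ⟨by linarith, trivial, rfl⟩⟩
    | tri t' =>
      obtain ⟨i', hi', hv, -⟩ := h
      obtain ⟨t, i, rfl, rfl, rfl⟩ := hf.tri.exists_corner hf.edge K.tri_closed hv
      refine ⟨.tri t, (f.tri.sym t).invFun z', rfl, by simp [pointMap], _, i, ?_, rfl, rfl⟩
      rwa [← (f.tri.sym t).nearCorner_toFun, PolySym.toFun_invFun]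
    | loz t' =>
      obtain ⟨i', hi', hv, -⟩ := h
      obtain ⟨t, i, rfl, rfl, rfl⟩ := hf.loz.exists_corner hf.edge K.loz_closed hv
      refine ⟨.loz t, (f.loz.sym t).invFun z', rfl, by simp [pointMap], _, i, ?_, rfl, rfl⟩
      rwa [← (f.loz.sym t).nearCorner_toFun, PolySym.toFun_invFun]
  | edge e =>
    cases d' with
    | vert w => exact h.elim
    | edge e' =>
      obtain ⟨rfl, hz, -⟩ := h
      refine ⟨.edge e, f.pointInv (.edge e) z', rfl, by simp, 0, rfl, ?_, rfl⟩
      simp only [pointInv]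
      cases f.flip e
      · exact hz
      · rw [cond_true, Complex.sub_re, Complex.one_re]
        constructor <;> linarith
    | tri t' =>
      obtain ⟨j, hj, he, -⟩ := h
      obtain ⟨t, i, rfl, rfl, rfl⟩ := hf.tri.lift e t' j he
      refine ⟨.tri t, (f.tri.sym t).invFun z', rfl, by simp [pointMap], _, i, ?_, rfl, rfl⟩
      rwa [← (f.tri.sym t).nearSide_toFun, PolySym.toFun_invFun]
    | loz t' =>
      obtain ⟨j, hj, he, -⟩ := h
      obtain ⟨t, i, rfl, rfl, rfl⟩ := hf.loz.lift e t' j he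
      refine ⟨.loz t, (f.loz.sym t).invFun z', rfl, by simp [pointMap], _, i, ?_, rfl, rfl⟩
      rwa [← (f.loz.sym t).nearSide_toFun, PolySym.toFun_invFun]
  | tri t =>
    cases d' with
    | vert w => exact h.elim
    | edge e' => exact h.elim
    | tri t' =>
      obtain ⟨rfl, h, -⟩ := h
      refine ⟨.tri t, (f.tri.sym t).invFun z', rfl, by simp [pointMap], 0, rfl, ?_, rfl⟩
      rwa [← (f.tri.sym t).inside_toFun, PolySym.toFun_invFun]
    | loz t' => exact h.elim
  | loz t =>
    cases d' with
    | vert w => exact h.elim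
    | edge e' => exact h.elim
    | loz t' =>
      obtain ⟨rfl, h, -⟩ := h
      refine ⟨.loz t, (f.loz.sym t).invFun z', rfl, by simp [pointMap], 0, rfl, ?_, rfl⟩
      rwa [← (f.loz.sym t).inside_toFun, PolySym.toFun_invFun]
    | tri t' => exact h.elim

theorem IsCovering.lift_unique (hf : f.IsCovering) {d₁ d₂ : K.Cell} {z₁ z₂ : ℂ} {c : K.Cell}
    (hd : f.cellMap d₁ = f.cellMap d₂) (hz : f.pointMap d₁ z₁ = f.pointMap d₂ z₂)
    (hz₁ : z₁ ∈ d₁.shape) (h₁ : InStar d₁ z₁ c) (h₂ : InStar d₂ z₂ c) : d₁ = d₂ := by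
  cases c with
  | vert v =>
    cases d₁ <;> cases d₂ <;> try (simp [cellMap] at hd; done)
    · obtain ⟨_, rfl, -⟩ := h₁
      obtain ⟨_, rfl, -⟩ := h₂
      rfl
    · rename_i e₁ e₂
      have he : f.edge e₁ = f.edge e₂ := Cell.edge.inj hd
      have key : ∀ e z, InStar (.edge e) z (.vert v) →
          (1 / 2 < (f.pointMap (.edge e) z).re ∧ K.start (e, f.flip e ^^ false) = v) ∨
          ((f.pointMap (.edge e) z).re < 1 / 2 ∧ K.start (e, f.flip e ^^ true) = v) := by
        rintro e z ⟨m, ⟨h, hv, -⟩ | ⟨h, hv, -⟩⟩ <;> simp only [pointMap, start] <;>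
          cases f.flip e <;> simp [hv] <;> norm_num at h ⊢ <;> grind
      rcases key e₁ z₁ h₁ with ⟨k₁, v₁⟩ | ⟨k₁, v₁⟩ <;>
        rcases key e₂ z₂ h₂ with ⟨k₂, v₂⟩ | ⟨k₂, v₂⟩
      · rw [hf.edge.unique e₁ e₂ false he (v₁.trans v₂.symm)]
      · rw [hz] at k₁; exact absurd k₁ (not_lt.2 k₂.le)
      · rw [hz] at k₁; exact absurd k₁ (not_lt.2 k₂.le)
      · rw [hf.edge.unique e₁ e₂ true he (v₁.trans v₂.symm)]
    · obtain ⟨m₁, i₁, hi₁, hv₁, -⟩ := h₁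
      obtain ⟨m₂, i₂, hi₂, hv₂, -⟩ := h₂
      have ht := Cell.tri.inj hd
      rw [hf.tri.corner_unique hf.edge K.tri_closed ht ?_ (hv₁.trans hv₂.symm)]
      rw [← (f.tri.sym _).nearCorner_toFun] at hi₁ hi₂
      refine triModel.nearCorner_unique _ _ _ (triModel.height_nonneg ((f.tri.sym _).toFun_mem hz₁))
        hi₁ ?_
      rw [show (f.tri.sym _).toFun z₁ = (f.tri.sym _).toFun z₂ from hz]
      exact hi₂
    · obtain ⟨m₁, i₁, hi₁, hv₁, -⟩ := h₁
      obtain ⟨m₂, i₂, hi₂, hv₂, -⟩ := h₂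
      have ht := Cell.loz.inj hd
      rw [hf.loz.corner_unique hf.edge K.loz_closed ht ?_ (hv₁.trans hv₂.symm)]
      rw [← (f.loz.sym _).nearCorner_toFun] at hi₁ hi₂
      refine lozModel.nearCorner_unique _ _ _ (lozModel.height_nonneg ((f.loz.sym _).toFun_mem hz₁))
        hi₁ ?_
      rw [show (f.loz.sym _).toFun z₁ = (f.loz.sym _).toFun z₂ from hz]
      exact hi₂
  | edge e =>
    cases d₁ <;> cases d₂ <;> try (simp [cellMap] at hd; done)
    · obtain ⟨_, h⟩ := h₁
      exact h.elim
    · obtain ⟨_, rfl, -⟩ := h₁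
      obtain ⟨_, rfl, -⟩ := h₂
      rfl
    · obtain ⟨m₁, i₁, hi₁, he₁, -⟩ := h₁
      obtain ⟨m₂, i₂, hi₂, he₂, -⟩ := h₂
      have ht := Cell.tri.inj hd
      rw [hf.tri.unique _ i₁ _ i₂ ht ?_ (he₁.trans he₂.symm)]
      rw [← (f.tri.sym _).nearSide_toFun] at hi₁ hi₂
      refine triModel.nearSide_unique _ _ _ hi₁ ?_
      rw [show (f.tri.sym _).toFun z₁ = (f.tri.sym _).toFun z₂ from hz]
      exact hi₂
    · obtain ⟨m₁, i₁, hi₁, he₁, -⟩ := h₁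
      obtain ⟨m₂, i₂, hi₂, he₂, -⟩ := h₂
      have ht := Cell.loz.inj hd
      rw [hf.loz.unique _ i₁ _ i₂ ht ?_ (he₁.trans he₂.symm)]
      rw [← (f.loz.sym _).nearSide_toFun] at hi₁ hi₂
      refine lozModel.nearSide_unique _ _ _ hi₁ ?_
      rw [show (f.loz.sym _).toFun z₁ = (f.loz.sym _).toFun z₂ from hz]
      exact hi₂
  | tri t =>
    obtain ⟨_, h₁⟩ := h₁
    obtain ⟨_, h₂⟩ := h₂
    cases d₁ <;> cases d₂ <;> simp only [StarAt] at h₁ h₂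
    rw [h₁.1, h₂.1]
  | loz t =>
    obtain ⟨_, h₁⟩ := h₁
    obtain ⟨_, h₂⟩ := h₂
    cases d₁ <;> cases d₂ <;> simp only [StarAt] at h₁ h₂
    rw [h₁.1, h₂.1]

theorem IsCovering.cellMap_surjective (hf : f.IsCovering) : Function.Surjective f.cellMap := by
  rintro (v | e | t | l)
  · obtain ⟨v, rfl⟩ := hf.vert_surjective v
    exact ⟨.vert v, rfl⟩
  · obtain ⟨e, rfl⟩ := hf.edge_surjective e
    exact ⟨.edge e, rfl⟩
  · obtain ⟨t, rfl⟩ := hf.tri_surjective t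
    exact ⟨.tri t, rfl⟩
  · obtain ⟨l, rfl⟩ := hf.loz_surjective l
    exact ⟨.loz l, rfl⟩

theorem IsCovering.surjective_realization (hf : f.IsCovering) :
    Function.Surjective f.realization := by
  intro y
  obtain ⟨⟨d', y, hy⟩, rfl⟩ := Quot.exists_rep y
  obtain ⟨d, rfl⟩ := hf.cellMap_surjective d'
  refine ⟨charMap d ((f.shapeIso d).symm ⟨y, hy⟩), congrArg (Quot.mk _) ?_⟩
  exact congrArg (Sigma.mk (f.cellMap d)) ((f.shapeIso d).apply_symm_apply _)

theorem isOpen_inStar (c : K.Cell) : IsOpen {a : K.PreRealization | InStar a.1 a.2 c} := by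
  refine isOpen_sigma_iff.2 fun d => ?_
  have : IsOpen {z | InStar d z c} := by
    simp only [InStar, Set.ofPred_exists]
    exact isOpen_iUnion fun m => isOpen_starAt d c m
  exact this.preimage continuous_subtype_val

theorem inStar_glue {a a' : K.PreRealization} (h : K.Glue a a') (c : K.Cell) :
    InStar a.1 a.2 c ↔ InStar a'.1 a'.2 c := by
  obtain ⟨p, q, hf, hx⟩ := glue_iff.1 h
  simp only [InStar, starAt_facet hf a'.2.2 hx]
  exact ⟨fun ⟨_, m', _, h⟩ => ⟨m', h⟩, fun ⟨m', h⟩ => ⟨_, m', rfl, h⟩⟩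

theorem dim_cellMap (c : K.Cell) : (f.cellMap c).dim = c.dim := by
  cases c <;> rfl

theorem IsCovering.isCoveringMap_realization [Nonempty K.Vert] (hf : f.IsCovering) :
    IsCoveringMap f.realization := by
  have : Nonempty K.PreRealization := ⟨⟨.vert (Classical.arbitrary _), 0, rfl⟩⟩
  refine isCoveringMap_quotMap f.continuous_preMap f.isOpenMap_preMap (fun _ _ => f.glue_preMap)
    hf.cellMap_surjective (S := fun a c => InStar a.1 a.2 c) (T := fun a c => InStar a.1 a.2 c)
    isOpen_inStar isOpen_inStar (fun _ _ c h => inStar_glue h c) (fun _ _ c h => inStar_glue h c)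
    (fun b => exists_starAt b.1 b.2.2) (fun a d h => (f.inStar_pointMap_iff _ _ _).1 h)
    (fun a c h => (f.inStar_pointMap_iff _ _ _).2 ⟨c, rfl, h⟩) ?_ ?_ ?_ ?_
  · rintro a c c' ⟨m, h⟩ ⟨m', h'⟩ hc
    refine (h.unique a.2.2 h' ?_).1
    rw [← dim_cellMap (f := f), hc, dim_cellMap]
  · rintro ⟨d', z', hz'⟩ c h
    obtain ⟨d, z, rfl, rfl, h'⟩ := hf.exists_lift h
    have hz : z ∈ d.shape := by
      have := f.pointInv_mem hz'
      rwa [f.pointInv_pointMap] at this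
    exact ⟨⟨d, z, hz⟩, rfl, h'⟩
  · rintro ⟨d₁, z₁, hz₁⟩ ⟨d₂, z₂, hz₂⟩ c h h₁ h₂
    have e1 : f.cellMap d₁ = f.cellMap d₂ := congrArg (fun a => a.1) h
    have e2 : f.pointMap d₁ z₁ = f.pointMap d₂ z₂ :=
      congrArg (fun a : L.PreRealization => (a.2 : ℂ)) h
    obtain rfl := hf.lift_unique e1 e2 hz₁ h₁ h₂
    refine PreRealization.ext rfl ?_
    have := congrArg (f.pointInv d₁) e2
    rwa [f.pointInv_pointMap, f.pointInv_pointMap] at this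
  -- A gluing of the image of `a` to a facet point lifts, because the facets of an image cell are
  -- the images of the facets.
  · rintro a b' h
    obtain ⟨p', q', hf', hx⟩ := glue_iff.1 h
    obtain ⟨d, p, q, hd, hd', hy⟩ := f.exists_facet hf'
    obtain ⟨d'', y, hy'⟩ := b'
    obtain rfl : f.cellMap d = d'' := hd'
    have e : f.preMap ⟨d, f.pointInv d y, f.pointInv_mem hy'⟩ = ⟨f.cellMap d, y, hy'⟩ :=
      PreRealization.ext rfl (f.pointMap_pointInv d y)
    refine ⟨⟨d, f.pointInv d y, f.pointInv_mem hy'⟩, glue_iff.2 ⟨p, q, hd, ?_⟩, e⟩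
    have := congrArg (f.pointInv a.1) (hy (f.pointInv d y))
    rw [f.pointInv_pointMap, f.pointMap_pointInv] at this
    rw [this]
    have h2 : f.pointMap a.1 a.2 = AffineMap.lineMap p' q' y.re := hx
    rw [← h2, f.pointInv_pointMap]

end Hom

end LozengeComplex

/-! ### Path characters -/

section PathCharacters

open scoped unitInterval Topology

/-- An assignment of group elements to paths which is multiplicative and invariant under
homotopies relative to the endpoints. -/
structure PathCharacter (X : Type*) [TopologicalSpace X] (π : Type*) [Group π] where
  toFun : ∀ {x y : X}, Path x y → π
  map_trans : ∀ {x y z : X} (γ : Path x y) (γ' : Path y z),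
    toFun (γ.trans γ') = toFun γ * toFun γ'
  map_homotopic : ∀ {x y : X} (γ γ' : Path x y), γ.Homotopic γ' → toFun γ = toFun γ'

namespace PathCharacter

variable {X Y π : Type*} [TopologicalSpace X] [TopologicalSpace Y] [Group π]

/-- The pull-back of a path character. -/
def comap (χ : PathCharacter X π) {f : Y → X} (hf : Continuous f) : PathCharacter Y π where
  toFun γ := χ.toFun (γ.map hf)
  map_trans γ γ' := by rw [Path.map_trans, χ.map_trans]
  map_homotopic γ γ' h := χ.map_homotopic _ _ (h.map ⟨f, hf⟩)

variable (χ : PathCharacter X π)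

theorem map_refl (x : X) : χ.toFun (Path.refl x) = 1 := by
  have h := χ.map_trans (Path.refl x) (Path.refl x)
  rw [Path.refl_trans_refl] at h
  exact left_eq_mul.1 h

theorem congr {x y x' y' : X} {γ : Path x y} {γ' : Path x' y'} (h : ∀ t, γ t = γ' t) :
    χ.toFun γ = χ.toFun γ' := by
  obtain rfl : x = x' := by simpa using h 0
  obtain rfl : y = y' := by simpa using h 1
  obtain rfl : γ = γ' := Path.ext (funext h)
  rfl

theorem eq_of_simplyConnected [SimplyConnectedSpace X] {x y : X} (γ γ' : Path x y) :
    χ.toFun γ = χ.toFun γ' :=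
  χ.map_homotopic _ _ (SimplyConnectedSpace.paths_homotopic γ γ')

/-- The product of the values of a character over the two ways around a square agree. -/
theorem square {G : I × I → X} (hG : Continuous G) {a b c d : X} (bot : Path a b) (top : Path c d)
    (left : Path a c) (right : Path b d) (hb : ∀ t, bot t = G (t, 0)) (ht : ∀ t, top t = G (t, 1))
    (hl : ∀ t, left t = G (0, t)) (hr : ∀ t, right t = G (1, t)) :
    χ.toFun bot * χ.toFun right = χ.toFun left * χ.toFun top := by
  have hI : ContractibleSpace I := (convex_Icc (0 : ℝ) 1).contractibleSpace ⟨0, by simp⟩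
  let p : Path (0 : I) 1 := ⟨ContinuousMap.id I, rfl, rfl⟩
  have h := (χ.comap hG).eq_of_simplyConnected
    ((p.prod (Path.refl 0)).trans ((Path.refl 1).prod p))
    (((Path.refl 0).prod p).trans (p.prod (Path.refl 1)))
  rw [map_trans, map_trans] at h
  have e1 : (χ.comap hG).toFun (p.prod (Path.refl 0)) = χ.toFun bot := χ.congr fun t => (hb t).symm
  have e2 : (χ.comap hG).toFun (p.prod (Path.refl 1)) = χ.toFun top := χ.congr fun t => (ht t).symm
  have e3 : (χ.comap hG).toFun ((Path.refl 0).prod p) = χ.toFun left :=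
    χ.congr fun t => (hl t).symm
  have e4 : (χ.comap hG).toFun ((Path.refl 1).prod p) = χ.toFun right :=
    χ.congr fun t => (hr t).symm
  rwa [e1, e2, e3, e4] at h

/-- A function is a primitive of a path character as soon as it is one locally. -/
theorem eq_mul_of_local {u : X → π}
    (h : ∀ x : X, ∃ U ∈ 𝓝 x, ∀ y z (γ : Path y z), (∀ t, γ t ∈ U) → u z = u y * χ.toFun γ)
    {x y : X} (γ : Path x y) : u y = u x * χ.toFun γ := by
  -- The claim says that `w` agrees at the two ends of the interval; the local hypothesis makes `w`
  -- locally constant on this connected space.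
  let w : I → π := fun t => u (γ t) * (χ.toFun (γ.subpath 0 t))⁻¹
  have hw : IsLocallyConstant w := by
    rw [IsLocallyConstant.iff_eventually_eq]
    intro t
    obtain ⟨U, hU, hγ⟩ := h (γ t)
    have h1 : Filter.Tendsto (fun s : I => Set.uIcc t s) (𝓝 t) (𝓝 t).smallSets :=
      Filter.Tendsto.uIcc tendsto_const_nhds Filter.tendsto_id
    have h2 := h1.eventually (Filter.eventually_smallSets_subset.2
      (γ.continuous.continuousAt.preimage_mem_nhds hU))
    filter_upwards [h2] with s hs
    have h3 := hγ _ _ (γ.subpath t s) fun r => by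
      have : γ.subpath t s r ∈ Set.range (γ.subpath t s) := ⟨r, rfl⟩
      rw [Path.range_subpath] at this
      obtain ⟨r', hr', h4⟩ := this
      rw [← h4]
      exact hs hr'
    have h5 := χ.map_homotopic _ _ ⟨Path.Homotopy.subpathTransSubpath γ 0 t s⟩
    rw [χ.map_trans] at h5
    simp only [w, ← h5, h3]
    group
  have h01 := hw.apply_eq_of_preconnectedSpace 1 0
  have e0 : χ.toFun (γ.subpath 0 0) = 1 := by rw [Path.subpath_self, map_refl]
  have e1 : χ.toFun (γ.subpath 0 1) = χ.toFun γ := χ.congr fun t => by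
    rw [Path.subpath_zero_one]; rfl
  simp only [w, e0, e1, inv_one, mul_one, γ.source, γ.target] at h01
  rw [← h01]
  group

/-- A function is a primitive of a path character on a set which can be contracted along paths on
which it is a primitive. -/
theorem eq_mul_of_contraction {u : X → π} {S : Set X} {H : X → C(I, X)}
    (hH : ContinuousOn H S) {q : X} (h0 : ∀ x, x = H x 0) (h1 : ∀ x ∈ S, H x 1 = q)
    (hu : ∀ x ∈ S, ∀ γ : Path x q, (∀ t, γ t = H x t) → u q = u x * χ.toFun γ)
    {y z : X} (γ : Path y z) (hγ : ∀ t, γ t ∈ S) : u z = u y * χ.toFun γ := by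
  have hc : Continuous fun t : I => H (γ t) := hH.comp_continuous γ.continuous hγ
  have hG : Continuous fun p : I × I => H (γ p.1) p.2 :=
    ContinuousMap.continuous_uncurry_of_continuous ⟨_, hc⟩
  have hy : y ∈ S := by simpa using hγ 0
  have hz : z ∈ S := by simpa using hγ 1
  let l : Path y q := ⟨H y, (h0 y).symm, h1 y hy⟩
  let r : Path z q := ⟨H z, (h0 z).symm, h1 z hz⟩
  -- The contraction sweeps `γ` over a square whose far side is constant at `q` and whose lateral
  -- sides are the tracks of `y` and `z`.
  have h := χ.square hG γ (Path.refl q) l r (fun t => h0 _) (fun t => (h1 _ (hγ t)).symm)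
    (fun t => by simp [l]) (fun t => by simp [r])
  have hl := hu y hy l fun _ => rfl
  have hr := hu z hz r fun _ => rfl
  rw [map_refl, mul_one] at h
  rw [hl, ← h, ← mul_assoc] at hr
  exact (mul_right_cancel hr).symm

end PathCharacter

/-- A path connected space on which every path character has a primitive is simply connected. -/
theorem simplyConnectedSpace_of_pathCharacter {X : Type*} [TopologicalSpace X]
    [PathConnectedSpace X]
    (h : ∀ (x : X) (χ : PathCharacter X (FundamentalGroup X x)ᵐᵒᵖ),
      ∃ u : X → (FundamentalGroup X x)ᵐᵒᵖ, ∀ y z (γ : Path y z), u z = u y * χ.toFun γ) :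
    SimplyConnectedSpace X := by
  rw [simply_connected_iff_loops_nullhomotopic]
  refine ⟨inferInstance, fun x γ => ?_⟩
  let T : ∀ y, Path x y := fun y => PathConnectedSpace.somePath x y
  open Path.Homotopic.Quotient in
  -- Every path is closed up to a loop at `x` by the chosen paths `T`. Passing to the opposite group
  -- puts products in the order of concatenation.
  let χ : PathCharacter X (FundamentalGroup X x)ᵐᵒᵖ :=
    { toFun := fun {y z} γ => MulOpposite.op
        (FundamentalGroup.fromPath (mk (((T y).trans γ).trans (T z).symm)))
      map_trans := by
        intro y z w γ γ'
        rw [← MulOpposite.op_mul, FundamentalGroup.mul_def]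
        congr 1
        change trans (trans (mk (T y)) (trans (mk γ) (mk γ'))) (symm (mk (T w))) =
          trans (trans (trans (mk (T y)) (mk γ)) (symm (mk (T z))))
            (trans (trans (mk (T z)) (mk γ')) (symm (mk (T w))))
        simp only [trans_assoc]
        rw [← trans_assoc (symm (mk (T z))), symm_trans, refl_trans]
      map_homotopic := by
        intro y z γ γ' h
        congr 2
        exact Quotient.sound (((Path.Homotopic.refl _).hcomp h).hcomp (Path.Homotopic.refl _)) }
  obtain ⟨u, hu⟩ := h x χ
  -- On a loop the two values of the primitive coincide, so the character is trivial there;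
  -- conjugating by `T x` then contracts `γ` itself.
  have h1 : χ.toFun γ = 1 := left_eq_mul.1 (hu x x γ)
  have h2 : χ.toFun (Path.refl x) = 1 := χ.map_refl x
  open Path.Homotopic.Quotient in
  have h3 : trans (trans (mk (T x)) (mk γ)) (symm (mk (T x))) =
      trans (trans (mk (T x)) (mk (Path.refl x))) (symm (mk (T x))) :=
    MulOpposite.op_injective (h1.trans h2.symm)
  open Path.Homotopic.Quotient in
  have h4 := congrArg (fun p => trans (symm (mk (T x))) (trans p (mk (T x)))) h3
  simp only [Path.Homotopic.Quotient.trans_assoc, Path.Homotopic.Quotient.symm_trans,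
    Path.Homotopic.Quotient.trans_refl] at h4
  simp only [← Path.Homotopic.Quotient.trans_assoc, Path.Homotopic.Quotient.symm_trans,
    Path.Homotopic.Quotient.refl_trans] at h4
  exact Path.Homotopic.Quotient.exact h4

end PathCharacters

/-! ### Simple connectedness of complexes -/

section SimplyConnected

open scoped Topology

namespace LozengeComplex

variable {K : LozengeComplex}

theorem continuous_charMap (c : K.Cell) : Continuous (charMap c) :=
  continuous_quot_mk.comp (continuous_sigmaMk (σ := fun c : K.Cell => c.shape))

/-- The straight path between two points of the model of a cell. -/
noncomputable def Cell.segment (c : K.Cell) (z w : c.shape) : Path z w where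
  toFun t := ⟨AffineMap.lineMap (z : ℂ) (w : ℂ) (t : ℝ), c.convex_shape.lineMap_mem z.2 w.2 t.2⟩
  continuous_toFun := by
    refine Continuous.subtype_mk ?_ _
    simp only [AffineMap.lineMap_apply_module]
    fun_prop
  source' := Subtype.ext (by simp)
  target' := Subtype.ext (by simp)

/-- The image in the realization of a straight path in the model of a cell. -/
noncomputable def cellPath (c : K.Cell) (z w : c.shape) : Path (charMap c z) (charMap c w) :=
  (c.segment z w).map (continuous_charMap c)

theorem cellPath_apply (c : K.Cell) (z w : c.shape) (t : unitInterval) :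
    cellPath c z w t = charMap c ⟨AffineMap.lineMap (z : ℂ) (w : ℂ) (t : ℝ),
      c.convex_shape.lineMap_mem z.2 w.2 t.2⟩ := rfl

instance (c : K.Cell) : ContractibleSpace c.shape :=
  c.convex_shape.contractibleSpace ⟨0, c.zero_mem⟩

section Character

variable {π : Type*} [Group π] (χ : PathCharacter K.Realization π)

/-- The model of a cell is convex, hence simply connected, so the pulled back character depends only
on endpoints. -/
theorem char_cellPath_mul (c : K.Cell) (x y z : c.shape) :
    χ.toFun (cellPath c x y) * χ.toFun (cellPath c y z) = χ.toFun (cellPath c x z) := by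
  rw [← χ.map_trans, cellPath, cellPath, ← Path.map_trans]
  exact (χ.comap (continuous_charMap c)).eq_of_simplyConnected _ _

theorem char_cellPath_self (c : K.Cell) (x : c.shape) : χ.toFun (cellPath c x x) = 1 :=
  left_eq_mul.1 (char_cellPath_mul χ c x x x).symm

theorem char_cellPath_symm (c : K.Cell) (x y : c.shape) :
    χ.toFun (cellPath c x y) = (χ.toFun (cellPath c y x))⁻¹ := by
  rw [eq_inv_iff_mul_eq_one, char_cellPath_mul, char_cellPath_self]

theorem lineMap_lineMap_re (p q a b : ℂ) (t : ℝ) :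
    AffineMap.lineMap (AffineMap.lineMap p q a.re) (AffineMap.lineMap p q b.re) t =
      AffineMap.lineMap p q (AffineMap.lineMap a b t).re := by
  simp only [AffineMap.lineMap_apply_module, Complex.add_re, Complex.real_smul, Complex.mul_re,
    Complex.ofReal_re, Complex.ofReal_im]
  push_cast
  ring

theorem char_cellPath_facet {c d : K.Cell} {p q : ℂ} (h : K.IsFacet c d p q) {x y : c.shape}
    {x' y' : d.shape} (hx : (x : ℂ) = AffineMap.lineMap p q (x' : ℂ).re)
    (hy : (y : ℂ) = AffineMap.lineMap p q (y' : ℂ).re) :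
    χ.toFun (cellPath c x y) = χ.toFun (cellPath d x' y') :=
  χ.congr fun t => by
    rw [cellPath_apply, cellPath_apply]
    exact h.charMap_eq _ _ (by rw [hx, hy, lineMap_lineMap_re])

/-- The value of a path character on an edge. -/
noncomputable def edgeChar (e : K.Edge) : π :=
  χ.toFun (cellPath (.edge e) ⟨0, left_mem_segment ℝ _ _⟩ ⟨1, right_mem_segment ℝ _ _⟩)

end Character

/-- Extension of a function on edges to oriented edges. -/
def signed {π : Type*} [Group π] (ℓ : K.Edge → π) (s : K.Edge × Bool) : π :=
  bif s.2 then ℓ s.1 else (ℓ s.1)⁻¹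

section Character

variable {π : Type*} [Group π] (χ : PathCharacter K.Realization π)

theorem char_triSide (t : K.Tri) (i : Fin 3) :
    χ.toFun (cellPath (.tri t) ⟨triCorner i, triModel.corner_mem i⟩
      ⟨triCorner (i + 1), triModel.corner_mem (i + 1)⟩) = signed (edgeChar χ) (K.triSide t i) := by
  have h := IsFacet.tri t i
  rw [signed]
  cases hb : (K.triSide t i).2 <;> rw [hb] at h <;> simp only [cond_true, cond_false] at h ⊢
  · rw [char_cellPath_symm]
    exact congrArg _ (char_cellPath_facet χ h (by simp) (by simp))
  · exact char_cellPath_facet χ h (by simp) (by simp)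

theorem char_lozSide (t : K.Loz) (i : Fin 4) :
    χ.toFun (cellPath (.loz t) ⟨lozCorner i, lozModel.corner_mem i⟩
      ⟨lozCorner (i + 1), lozModel.corner_mem (i + 1)⟩) = signed (edgeChar χ) (K.lozSide t i) := by
  have h := IsFacet.loz t i
  rw [signed]
  cases hb : (K.lozSide t i).2 <;> rw [hb] at h <;> simp only [cond_true, cond_false] at h ⊢
  · rw [char_cellPath_symm]
    exact congrArg _ (char_cellPath_facet χ h (by simp) (by simp))
  · exact char_cellPath_facet χ h (by simp) (by simp)

/-- The vertex attached to the point `0` of the model of a cell. -/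
def Cell.base : K.Cell → K.Vert
  | .vert v => v
  | .edge e => K.src e
  | .tri t => K.start (K.triSide t 0)
  | .loz l => K.start (K.lozSide l 0)

theorem eq_of_step {n : ℕ} [NeZero n] {g h s : Fin n → π} (h0 : g 0 = h 0)
    (hg : ∀ i, g (i + 1) = g i * s i) (hh : ∀ i, h (i + 1) = h i * s i) (i : Fin n) :
    g i = h i := by
  have key : ∀ k : ℕ, g (Fin.ofNat n k) = h (Fin.ofNat n k) := by
    intro k
    induction k with
    | zero => exact h0
    | succ k ih =>
      have e : Fin.ofNat n (k + 1) = Fin.ofNat n k + 1 := Fin.ext (by simp [Fin.val_add])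
      rw [e, hg, hh, ih]
  simpa using key i

theorem finish_eq_mul {v : K.Vert → π} {ℓ : K.Edge → π} (hv : ∀ e, v (K.tgt e) = v (K.src e) * ℓ e)
    (s : K.Edge × Bool) : v (K.finish s) = v (K.start s) * signed ℓ s := by
  obtain ⟨e, b⟩ := s
  cases b <;> simp [finish, start, signed, hv]

variable {χ} {v : K.Vert → π} (hv : ∀ e, v (K.tgt e) = v (K.src e) * edgeChar χ e)

variable (χ v) in
/-- Extension of a function on vertices along straight paths in cells. -/
noncomputable def extend (a : K.PreRealization) : π :=
  v a.1.base * χ.toFun (cellPath a.1 ⟨0, a.1.zero_mem⟩ a.2)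

theorem extend_mul_cellPath (c : K.Cell) (x y : c.shape) :
    extend χ v ⟨c, y⟩ = extend χ v ⟨c, x⟩ * χ.toFun (cellPath c x y) := by
  simp only [extend]
  rw [mul_assoc, char_cellPath_mul]

include hv

/-- Both sides agree at corner `0`, the base point, and pick up the same signed edge value on
passing to the next corner. -/
theorem extend_triCorner (t : K.Tri) (i : Fin 3) :
    extend χ v ⟨.tri t, triCorner i, triModel.corner_mem i⟩ = v (K.start (K.triSide t i)) := by
  refine eq_of_step (g := fun i => extend χ v ⟨.tri t, triCorner i, triModel.corner_mem i⟩)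
    (h := fun i => v (K.start (K.triSide t i))) (s := fun i => signed (edgeChar χ) (K.triSide t i))
    ?_ ?_ ?_ i
  · exact (congrArg (_ * ·) (char_cellPath_self χ (.tri t) ⟨0, _⟩)).trans (mul_one _)
  · intro i
    rw [← char_triSide]
    exact extend_mul_cellPath _ _ _
  · intro i
    rw [← finish_eq_mul hv]
    exact congrArg v (K.tri_closed t i)

theorem extend_lozCorner (t : K.Loz) (i : Fin 4) :
    extend χ v ⟨.loz t, lozCorner i, lozModel.corner_mem i⟩ = v (K.start (K.lozSide t i)) := by
  refine eq_of_step (g := fun i => extend χ v ⟨.loz t, lozCorner i, lozModel.corner_mem i⟩)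
    (h := fun i => v (K.start (K.lozSide t i))) (s := fun i => signed (edgeChar χ) (K.lozSide t i))
    ?_ ?_ ?_ i
  · exact (congrArg (_ * ·) (char_cellPath_self χ (.loz t) ⟨0, _⟩)).trans (mul_one _)
  · intro i
    rw [← char_lozSide]
    exact extend_mul_cellPath _ _ _
  · intro i
    rw [← finish_eq_mul hv]
    exact congrArg v (K.loz_closed t i)

theorem extend_facet_zero {c d : K.Cell} {p q : ℂ} (h : K.IsFacet c d p q) :
    extend χ v ⟨c, p, h.mem.1⟩ = v d.base := by
  cases h with
  | src e => exact (congrArg (_ * ·) (char_cellPath_self χ (.edge e) ⟨0, _⟩)).trans (mul_one _)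
  | tgt e => exact (hv e).symm
  | tri t i =>
    refine (extend_triCorner hv t _).trans (congrArg v ?_)
    simp only [Cell.base]
    cases hb : (K.triSide t i).2
    · exact (K.tri_closed t i).trans (by rw [hb]; rfl)
    · rw [start, cond_true, hb]; rfl
  | loz t i =>
    refine (extend_lozCorner hv t _).trans (congrArg v ?_)
    simp only [Cell.base]
    cases hb : (K.lozSide t i).2
    · exact (K.loz_closed t i).trans (by rw [hb]; rfl)
    · rw [start, cond_true, hb]; rfl

/-- Along a facet both extensions grow by the same character value, so agreement at its initial
point is enough. This lets `extend` descend to the realization. -/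
theorem extend_glue {a b : K.PreRealization} (hab : K.Glue a b) : extend χ v a = extend χ v b := by
  obtain ⟨p, q, h, hx⟩ := glue_iff.1 hab
  obtain ⟨c, x⟩ := a
  obtain ⟨d, y⟩ := b
  dsimp only at h hx
  rw [extend_mul_cellPath c ⟨p, h.mem.1⟩ x, extend_facet_zero hv h,
    char_cellPath_facet χ h (x' := ⟨0, d.zero_mem⟩) (y' := y) (by simp) hx]
  rfl

end Character

/-! ### The contraction of stars -/

open Classical in
/-- The point of the model of a cell to which a point in the star of `c` is contracted. -/
noncomputable def starTarget (c : K.Cell) (a : K.PreRealization) : a.1.shape :=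
  if h : InStar a.1 a.2 c then ⟨h.choose, h.choose_spec.mem⟩ else a.2

theorem starTarget_eq {c : K.Cell} {a : K.PreRealization} {m : ℂ} (h : StarAt a.1 a.2 c m) :
    starTarget c a = ⟨m, h.mem⟩ := by
  have h' : InStar a.1 a.2 c := ⟨m, h⟩
  rw [starTarget, dif_pos h']
  exact Subtype.ext (h'.choose_spec.unique a.2.2 h rfl).2

/-- The contraction of the star of `c`; points outside of the star are fixed. -/
noncomputable def starContraction (c : K.Cell) (a : K.PreRealization) :
    C(unitInterval, K.Realization) :=
  (cellPath a.1 a.2 (starTarget c a)).toContinuousMap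

/-- For a point on a side, the contraction target lies on the same side and corresponds to the
target in the edge (`starAt_facet`), so the straight motions in both models are glued. Outside the
star both motions are constant. -/
theorem starContraction_glue (c : K.Cell) {a b : K.PreRealization} (hab : K.Glue a b) :
    starContraction c a = starContraction c b := by
  ext t
  by_cases h : InStar a.1 a.2 c
  · have h2 := (Hom.inStar_glue hab c).1 h
    obtain ⟨p, q, hf, hx⟩ := glue_iff.1 hab
    obtain ⟨m, hm⟩ := h
    obtain ⟨m', hmm, hm'⟩ := (starAt_facet hf b.2.2 hx c m).1 hm
    change cellPath a.1 a.2 (starTarget c a) t = cellPath b.1 b.2 (starTarget c b) t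
    rw [starTarget_eq hm, starTarget_eq hm']
    exact hf.charMap_eq _ _ (by simp only [hx, hmm]; exact lineMap_lineMap_re _ _ _ _ _)
  · have h2 := mt (Hom.inStar_glue hab c).2 h
    change cellPath a.1 a.2 (starTarget c a) t = cellPath b.1 b.2 (starTarget c b) t
    rw [starTarget, dif_neg h, starTarget, dif_neg h2]
    have key : ∀ a : K.PreRealization, cellPath a.1 a.2 a.2 t = Quot.mk _ a := by
      intro a
      rw [cellPath_apply]
      exact congrArg (charMap a.1) (Subtype.ext (by simp))
    exact (key a).trans ((Quot.sound hab).trans (key b).symm)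

/-- Within one model the target is locally constant, since the points with a given target `m` form
an open set; the segment to a fixed target varies continuously. -/
theorem continuousOn_starContraction (c : K.Cell) :
    ContinuousOn (starContraction c) {a : K.PreRealization | InStar a.1 a.2 c} := by
  rintro ⟨d, z⟩ ⟨m, hm⟩
  refine ContinuousAt.continuousWithinAt ?_
  rw [← (Topology.IsOpenEmbedding.sigmaMk (σ := fun c : K.Cell => c.shape)
    (i := d)).continuousAt_iff]
  have hc : Continuous fun z : d.shape => (cellPath d z ⟨m, hm.mem⟩).toContinuousMap := by
    refine ContinuousMap.continuous_of_continuous_uncurry _ ?_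
    refine (continuous_charMap d).comp (Continuous.subtype_mk ?_ _)
    simp only [AffineMap.lineMap_apply_module]
    fun_prop
  refine hc.continuousAt.congr ?_
  have ho : IsOpen {z : d.shape | StarAt d z c m} :=
    (isOpen_starAt d c m).preimage continuous_subtype_val
  filter_upwards [ho.mem_nhds hm] with w hw
  have := starTarget_eq (a := ⟨d, w⟩) hw
  simp only [Function.comp, starContraction]
  rw [this]

/-- A connected complex is simply connected if every function on edges with values in a group
whose products around all faces are trivial is the coboundary of a function on vertices. -/
theorem simplyConnectedSpace_realization [Nonempty K.Vert]
    (hconn : ∀ P : K.Vert → Prop, (∀ e, P (K.src e) ↔ P (K.tgt e)) → (∃ v, P v) → ∀ v, P v)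
    (hcocycle : ∀ (π : Type) [Group π] (ℓ : K.Edge → π),
      (∀ t, signed ℓ (K.triSide t 0) * signed ℓ (K.triSide t 1) * signed ℓ (K.triSide t 2) = 1) →
      (∀ l, signed ℓ (K.lozSide l 0) * signed ℓ (K.lozSide l 1) * signed ℓ (K.lozSide l 2) *
        signed ℓ (K.lozSide l 3) = 1) →
      ∃ v : K.Vert → π, ∀ e, v (K.tgt e) = v (K.src e) * ℓ e) :
    SimplyConnectedSpace K.Realization := by
  have hloop : ∀ {π : Type} [Group π] (χ : PathCharacter K.Realization π),
      ∃ u : K.Realization → π, ∀ y z (γ : Path y z), u z = u y * χ.toFun γ := by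
    intro π _ χ
    obtain ⟨v, hv⟩ := hcocycle π (edgeChar χ)
      (fun t => by
        rw [← char_triSide, ← char_triSide, ← char_triSide]
        exact (congrArg (· * _) (char_cellPath_mul χ _ _ _ _)).trans
          ((char_cellPath_mul χ _ _ _ _).trans (char_cellPath_self χ _ _)))
      (fun t => by
        rw [← char_lozSide, ← char_lozSide, ← char_lozSide, ← char_lozSide]
        exact (congrArg (· * _) (congrArg (· * _) (char_cellPath_mul χ _ _ _ _))).trans
          ((congrArg (· * _) (char_cellPath_mul χ _ _ _ _)).trans
          ((char_cellPath_mul χ _ _ _ _).trans (char_cellPath_self χ _ _))))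
    let u : K.Realization → π := Quot.lift (extend χ v) fun _ _ h => extend_glue hv h
    refine ⟨u, fun y z γ => χ.eq_mul_of_local (u := u) ?_ γ⟩
    intro x
    induction x using Quot.ind with | mk a
    obtain ⟨c, hc⟩ := exists_starAt a.1 a.2.2
    let S : Set K.Realization := {x | Quot.lift (fun a : K.PreRealization => InStar a.1 a.2 c)
      (fun a b h => propext (Hom.inStar_glue h c)) x}
    have hS : IsOpen S := isQuotientMap_quot_mk.isOpen_preimage.1 (Hom.isOpen_inStar c)
    refine ⟨S, hS.mem_nhds hc, fun y z γ hγ => ?_⟩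
    let H : K.Realization → C(unitInterval, K.Realization) :=
      Quot.lift (starContraction c) fun _ _ h => starContraction_glue c h
    have hH : ContinuousOn H S := by
      rw [continuousOn_open_iff hS]
      intro W hW
      -- Because the star is open, continuity on it is a statement about open sets and can be tested
      -- before gluing.
      exact (isQuotientMap_quot_mk (r := K.Glue)).isOpen_preimage.1 <|
          (continuousOn_open_iff (Hom.isOpen_inStar c)).1 (continuousOn_starContraction c) W hW
    refine χ.eq_mul_of_contraction (H := H) hH (q := charMap c ⟨0, c.zero_mem⟩) ?_ ?_ ?_ γ hγ
    · intro x
      induction x using Quot.ind with | mk a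
      exact (cellPath a.1 a.2 (starTarget c a)).source.symm
    · intro x hx
      induction x using Quot.ind with | mk a
      obtain ⟨m, hm⟩ : InStar a.1 a.2 c := hx
      refine (cellPath a.1 a.2 (starTarget c a)).target.trans ?_
      rw [starTarget_eq hm]
      exact hm.charMap_eq
    · intro x hx γ hγ
      induction x using Quot.ind with | mk a
      obtain ⟨m, hm⟩ : InStar a.1 a.2 c := hx
      have e1 : χ.toFun γ = χ.toFun (cellPath a.1 a.2 (starTarget c a)) := χ.congr hγ
      rw [e1, ← hm.charMap_eq, starTarget_eq hm]
      exact extend_mul_cellPath a.1 a.2 ⟨m, hm.mem⟩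
  -- Every point is joined to the base vertex of its cell, and vertices are joined to each other
  -- along edges by `hconn`.
  have hjoin : ∀ x : K.Realization, Joined x (vertexPoint (Classical.arbitrary K.Vert)) := by
    have hv : ∀ v : K.Vert, Joined (vertexPoint v) (vertexPoint (Classical.arbitrary K.Vert)) := by
      refine hconn _ (fun e => ?_) ⟨Classical.arbitrary _, Joined.refl _⟩
      have h1 : Joined (vertexPoint (K.src e)) (vertexPoint (K.tgt e)) := by
        have h : Joined (charMap (.edge e) ⟨0, (IsFacet.src e).mem.1⟩)
            (charMap (.edge e) ⟨1, (IsFacet.tgt e).mem.1⟩) := ⟨cellPath _ _ _⟩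
        have h0 : charMap (.edge e) ⟨0, (IsFacet.src e).mem.1⟩ = vertexPoint (K.src e) :=
          (IsFacet.src e).charMap_eq _ rfl (by simp)
        have h1 : charMap (.edge e) ⟨1, (IsFacet.tgt e).mem.1⟩ = vertexPoint (K.tgt e) :=
          (IsFacet.tgt e).charMap_eq _ rfl (by simp)
        rwa [h0, h1] at h
      exact ⟨fun h => h1.symm.trans h, fun h => h1.trans h⟩
    intro x
    induction x using Quot.ind with | mk a
    obtain ⟨c, m, hm⟩ := exists_starAt a.1 a.2.2
    have h1 : Joined (Quot.mk K.Glue a) (charMap a.1 ⟨0, a.1.zero_mem⟩) := ⟨cellPath a.1 a.2 _⟩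
    refine h1.trans ?_
    obtain ⟨d, z⟩ := a
    cases d with
    | vert v => exact hv v
    | edge e =>
      refine Joined.trans ?_ (hv (K.src e))
      have h0 : charMap (.edge e) ⟨0, (IsFacet.src e).mem.1⟩ = vertexPoint (K.src e) :=
        (IsFacet.src e).charMap_eq _ rfl (by simp)
      exact h0 ▸ Joined.refl _
    | tri t =>
      refine Joined.trans ?_ (hv (K.start (K.triSide t 0)))
      rw [← charMap_triCorner]
      exact Joined.refl _
    | loz l =>
      refine Joined.trans ?_ (hv (K.start (K.lozSide l 0)))
      rw [← charMap_lozCorner]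
      exact Joined.refl _
  have : PathConnectedSpace K.Realization :=
    ⟨⟨vertexPoint (Classical.arbitrary _)⟩, fun x y => (hjoin x).trans (hjoin y).symm⟩
  exact simplyConnectedSpace_of_pathCharacter fun x χ => hloop χ

end LozengeComplex

end SimplyConnected

/-! ### The Brady complex is simply connected -/

namespace Brady

open LozengeComplex

/-- A representation of `G`, given by three elements with commuting first and third, cyclically
permuted under conjugation by their product, whose fourth power is trivial. -/
def representation {H : Type*} [Group H] (a : Fin 3 → H) (h02 : a 0 * a 2 = a 2 * a 0)
    (h0 : a 0 * a 1 * a 2 * a 0 = a 1 * (a 0 * a 1 * a 2))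
    (h1 : a 0 * a 1 * a 2 * a 1 = a 2 * (a 0 * a 1 * a 2))
    (h4 : (a 0 * a 1 * a 2) ^ 4 = 1) : G →* H :=
  PresentedGroup.toGroup (f := a) <| by
    rintro r (rfl | rfl | rfl | rfl)
    · simp only [map_mul, map_inv, FreeGroup.lift_apply_of, mul_inv_eq_one]
      exact h02
    · simp only [map_mul, map_inv, FreeGroup.lift_apply_of, mul_inv_eq_one]
      -- Multiplied by `a 2`, and with `a 0`, `a 2` exchanged, the left side of the braid relation
      -- becomes the product of all three times `a 0`, to which `h0` applies. The other braid
      -- relation is treated alike, with `a 0` on the left.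
      apply mul_right_cancel (b := a 2)
      rw [mul_assoc _ (a 0), h02, ← mul_assoc, h0]
      simp only [mul_assoc]
    · simp only [map_mul, map_inv, FreeGroup.lift_apply_of, mul_inv_eq_one]
      apply mul_left_cancel (a := a 0)
      rw [show a 0 * (a 1 * a 2 * a 1) = a 0 * a 1 * a 2 * a 1 by simp only [mul_assoc], h1]
      simp only [← mul_assoc, h02]
    · simp only [map_mul, map_pow, FreeGroup.lift_apply_of]
      exact h4

section Representation

variable {H : Type*} [Group H] (a : Fin 3 → H) (h02 : a 0 * a 2 = a 2 * a 0)
    (h0 : a 0 * a 1 * a 2 * a 0 = a 1 * (a 0 * a 1 * a 2))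
    (h1 : a 0 * a 1 * a 2 * a 1 = a 2 * (a 0 * a 1 * a 2))
    (h4 : (a 0 * a 1 * a 2) ^ 4 = 1)

theorem representation_σ₁ : representation a h02 h0 h1 h4 σ₁ = a 0 := PresentedGroup.toGroup.of _

theorem representation_σ₃ : representation a h02 h0 h1 h4 σ₃ = a 2 := PresentedGroup.toGroup.of _

theorem representation_δ : representation a h02 h0 h1 h4 δ = a 0 * a 1 * a 2 := by
  rw [δ, map_mul, map_mul]
  exact congrArg₂ _ (congrArg₂ _ (PresentedGroup.toGroup.of _) (PresentedGroup.toGroup.of _))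
    (PresentedGroup.toGroup.of _)

end Representation

/-- The group `G` is generated by `σ₁` and `δ`. -/
theorem induction_on_mul {P : G → Prop} (h1 : P 1) (hσ : ∀ g, P g ↔ P (g * σ₁))
    (hδ : ∀ g, P g ↔ P (g * δ)) (g : G) : P g := by
  -- Conjugation by `δ` carries `σ₁` to `σ₂` and `σ₂` to `σ₃`, so invariance under `σ₁` and `δ`
  -- spreads to all generators.
  have hσ₂ : ∀ g, P g ↔ P (g * σ₂) := fun g => by
    rw [hδ g, hσ, hδ (g * σ₂), mul_assoc, delta_mul_σ₁, mul_assoc]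
  have hσ₃ : ∀ g, P g ↔ P (g * σ₃) := fun g => by
    rw [hδ g, hσ₂, hδ (g * σ₃), mul_assoc, delta_mul_σ₂, mul_assoc]
  have hgen : ∀ (i : Fin 3) g, P g ↔ P (g * PresentedGroup.of i) := by
    intro i
    fin_cases i
    exacts [hσ, hσ₂, hσ₃]
  have key : ∀ k ∈ Subgroup.closure (Set.range (PresentedGroup.of (rels := relators))),
      ∀ g, P g ↔ P (g * k) := by
    intro k hk
    induction hk using Subgroup.closure_induction with
    | mem x hx =>
      obtain ⟨i, rfl⟩ := hx
      exact hgen i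
    | one => simp
    | mul x y _ _ hx hy => intro g; rw [hx, hy, mul_assoc]
    | inv x _ hx => intro g; rw [hx (g * x⁻¹), inv_mul_cancel_right]
  have := (key g (by rw [PresentedGroup.closure_range_of]; trivial) 1).1 h1
  rwa [one_mul] at this

/-- A function on a group invariant under right multiplication by an element is constant on the
cosets of the subgroup generated by it. -/
theorem eq_mk_out {H α : Type*} [Group H] {d : H} {u : H → α} (hu : ∀ g, u (g * d) = u g) (g : H) :
    u (QuotientGroup.mk g : H ⧸ Subgroup.zpowers d).out = u g := by
  obtain ⟨⟨k, hk⟩, h⟩ := QuotientGroup.mk_out_eq_mul (Subgroup.zpowers d) g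
  rw [h]
  change u (g * k) = u g
  clear h
  rw [Subgroup.zpowers_eq_closure] at hk
  induction hk using Subgroup.closure_induction generalizing g with
  | mem x hx => rw [Set.mem_singleton_iff.1 hx, hu]
  | one => rw [mul_one]
  | mul x y _ _ hx hy => rw [← mul_assoc, hy, hx]
  | inv x _ hx => rw [← hx (g * x⁻¹), inv_mul_cancel_right]

theorem eq_mk_out_iff {d : G} {u : G → Prop} (hu : ∀ g, u (g * d) ↔ u g) (g : G) :
    u (QuotientGroup.mk g : G ⧸ Subgroup.zpowers d).out ↔ u g :=
  iff_of_eq (eq_mk_out (fun g => propext (hu g)) g)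

theorem delta_sq_mul_delta_sq : δ ^ 2 * δ ^ 2 = 1 := by rw [← pow_add, delta_pow_four]

theorem delta_sq_mul_σ₃ : δ ^ 2 * σ₃ = σ₁ * δ ^ 2 := by
  have h := congrArg (fun x => δ ^ 2 * x * δ ^ 2) delta_sq_mul_σ₁
  simp only [← mul_assoc, delta_sq_mul_delta_sq, one_mul] at h
  rw [mul_assoc _ (δ ^ 2), delta_sq_mul_delta_sq, mul_one] at h
  exact h.symm

theorem δσ₂ : δ * σ₁ * δ = σ₂ * δ ^ 2 := by
  rw [delta_mul_σ₁, mul_assoc, pow_two]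

section Cocycle

variable {π : Type} [Group π] (ℓ : G → π)

/-- Right multiplication by an element on the covering defined by a cocycle. -/
def mulTwist (s d : G) : Equiv.Perm (G × π) where
  toFun x := (x.1 * s, x.2 * ℓ (x.1 * d))
  invFun x := (x.1 * s⁻¹, x.2 * (ℓ (x.1 * s⁻¹ * d))⁻¹)
  left_inv x := by simp
  right_inv x := by simp

variable {ℓ} (htri : ∀ g, ℓ g * ℓ (g * (σ₁ * δ)) * ℓ (g * (σ₁ * δ) * (σ₁ * δ)) = 1)
  (hloz : ∀ g, ℓ g * ℓ (g * σ₁ * δ ^ 2) = ℓ (g * δ ^ 2) * ℓ (g * σ₃))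

include htri hloz in
/-- A cocycle on the edges of the Brady complex is a coboundary. -/
theorem exists_eq_mul : ∃ u : G → π, (∀ g, u (g * σ₁) = u g * ℓ g) ∧ ∀ g, u (g * δ) = u g := by
  -- The shifts `1`, `δ`, `δ ^ 2` occur because the edges from `[g]` to `[g σ₁]`, `[g σ₂]`, `[g σ₃]`
  -- are `g`, `g δ`, `g δ²`. Opposites are taken because these are right multiplications.
  let a : Fin 3 → (Equiv.Perm (G × π))ᵐᵒᵖ := ![.op (mulTwist ℓ σ₁ 1), .op (mulTwist ℓ σ₂ δ),
    .op (mulTwist ℓ σ₃ (δ ^ 2))]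
  -- The three labels collected along `σ₁`, `σ₂`, `σ₃` are those of the triangle of `g`, so they
  -- multiply to `1`.
  have ha : ∀ x, (a 0 * a 1 * a 2).unop x = (x.1 * δ, x.2) := by
    rintro ⟨g, c⟩
    change (g * σ₁ * σ₂ * σ₃, c * ℓ (g * 1) * ℓ (g * σ₁ * δ) * ℓ (g * σ₁ * σ₂ * δ ^ 2)) = (g * δ, c)
    have h := htri g
    rw [mul_assoc _ (σ₁ * δ), mul_assoc σ₁ δ, ← mul_assoc δ, δσ₂] at h
    simp only [mul_assoc] at h
    simp only [δ, mul_assoc, mul_one] at h ⊢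
    rw [h, mul_one]
  have h0 : ∀ x, (a 0).unop x = (x.1 * σ₁, x.2 * ℓ x.1) := by
    intro x
    change (x.1 * σ₁, x.2 * ℓ (x.1 * 1)) = _
    rw [mul_one]
  have h1 : ∀ x, (a 1).unop x = (x.1 * σ₂, x.2 * ℓ (x.1 * δ)) := fun _ => rfl
  have h2 : ∀ x, (a 2).unop x = (x.1 * σ₃, x.2 * ℓ (x.1 * δ ^ 2)) := fun _ => rfl
  -- Commutation of the first and third permutations is the lozenge condition. The remaining
  -- relations follow from the untwisted action of the product and relations in `G`.
  let φ := representation a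
    (MulOpposite.unop_injective <| Equiv.ext fun x => by
      simp only [MulOpposite.unop_mul, Equiv.Perm.mul_apply, h0, h2]
      rw [mul_assoc x.2, hloz, mul_assoc x.1, comm13, ← mul_assoc x.1, mul_assoc x.2])
    (MulOpposite.unop_injective <| Equiv.ext fun x => by
      rw [MulOpposite.unop_mul _ (a _), MulOpposite.unop_mul (a _), Equiv.Perm.mul_apply,
        Equiv.Perm.mul_apply, ha, ha, h0, h1]
      simp only [mul_assoc, delta_mul_σ₁])
    (MulOpposite.unop_injective <| Equiv.ext fun x => by
      rw [MulOpposite.unop_mul _ (a _), MulOpposite.unop_mul (a _), Equiv.Perm.mul_apply,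
        Equiv.Perm.mul_apply, ha, ha, h1, h2]
      simp only [mul_assoc, delta_mul_σ₂, pow_two])
    (MulOpposite.unop_injective <| Equiv.ext fun x => by
      rw [MulOpposite.unop_pow]
      simp only [pow_succ, pow_zero, one_mul, Equiv.Perm.mul_apply, ha]
      simp only [mul_assoc]
      have := delta_pow_four
      simp only [pow_succ, pow_zero, one_mul, mul_assoc] at this
      rw [this, mul_one]
      rfl)
  have hσ : ∀ g x, (φ (g * σ₁)).unop x =
      (((φ g).unop x).1 * σ₁, ((φ g).unop x).2 * ℓ ((φ g).unop x).1) := by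
    intro g x
    rw [map_mul, representation_σ₁, MulOpposite.unop_mul, Equiv.Perm.mul_apply, h0]
  have hδ : ∀ g x, (φ (g * δ)).unop x = (((φ g).unop x).1 * δ, ((φ g).unop x).2) := by
    intro g x
    rw [map_mul, representation_δ, MulOpposite.unop_mul, Equiv.Perm.mul_apply, ha]
  -- The action lifts right multiplication, so the orbit of `(1, 1)` is a graph over `G`; the
  -- primitive is its second coordinate.
  have hfst : ∀ g, ((φ g).unop (1, 1)).1 = g := by
    refine induction_on_mul ?_ (fun g => ?_) (fun g => ?_)
    · rw [map_one]; rfl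
    · rw [hσ, mul_left_inj]
    · rw [hδ, mul_left_inj]
  refine ⟨fun g => ((φ g).unop (1, 1)).2, fun g => ?_, fun g => ?_⟩
  · simp only [hσ, hfst]
  · simp only [hδ]

end Cocycle

theorem simplyConnectedSpace_bradyComplex : SimplyConnectedSpace bradyComplex.Realization := by
  have : Nonempty bradyComplex.Vert := ⟨(QuotientGroup.mk 1 : Vert)⟩
  refine simplyConnectedSpace_realization ?_ ?_
  · rintro P hP ⟨v, hv⟩ w
    obtain ⟨g, rfl⟩ := QuotientGroup.mk_surjective v
    obtain ⟨h, rfl⟩ := QuotientGroup.mk_surjective w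
    have key : ∀ k, P (QuotientGroup.mk (g * k) : Vert) := by
      refine induction_on_mul ?_ (fun k => ?_) (fun k => ?_)
      · rwa [mul_one]
      · rw [← mul_assoc]
        exact hP (g * k)
      · rw [← mul_assoc, mk_mul_delta]
    have := key (g⁻¹ * h)
    rwa [mul_inv_cancel_left] at this
  · intro π _ (ℓ : G → π) htri hloz
    -- The complex provides the condition only at the chosen coset representative. It is invariant
    -- under cyclic rotation of the triangle, and for lozenges under the half turn, so it holds at
    -- every `g`.
    have htri' : ∀ g, ℓ g * ℓ (g * (σ₁ * δ)) * ℓ (g * (σ₁ * δ) * (σ₁ * δ)) = 1 := by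
      intro g
      refine (eq_mk_out_iff (d := σ₁ * δ)
        (u := fun g => ℓ g * ℓ (g * (σ₁ * δ)) * ℓ (g * (σ₁ * δ) * (σ₁ * δ)) = 1) ?_ g).1
        (htri (QuotientGroup.mk g))
      intro g
      have h3 : g * (σ₁ * δ) * (σ₁ * δ) * (σ₁ * δ) = g := by
        rw [mul_assoc g, mul_assoc g, σ₁_mul_delta_pow_three, mul_one]
      rw [h3, mul_eq_one_comm, ← mul_assoc]
    have hloz' : ∀ g, ℓ g * ℓ (g * σ₁ * δ ^ 2) = ℓ (g * δ ^ 2) * ℓ (g * σ₃) := by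
      intro g
      refine (eq_mk_out_iff (d := δ ^ 2)
        (u := fun g => ℓ g * ℓ (g * σ₁ * δ ^ 2) = ℓ (g * δ ^ 2) * ℓ (g * σ₃)) ?_ g).1 ?_
      · intro g
        rw [mul_assoc g (δ ^ 2) (δ ^ 2), delta_sq_mul_delta_sq, mul_one, mul_assoc g (δ ^ 2) σ₁,
          delta_sq_mul_σ₁, ← mul_assoc g σ₃, mul_assoc _ (δ ^ 2) (δ ^ 2), delta_sq_mul_delta_sq,
          mul_one, mul_assoc g (δ ^ 2) σ₃, delta_sq_mul_σ₃, ← mul_assoc g σ₁, eq_comm]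
      · generalize hk : (QuotientGroup.mk g : G ⧸ Subgroup.zpowers (δ ^ 2)).out = k
        have h : ℓ (k * σ₁ * δ ^ 2) * (ℓ (k * σ₃))⁻¹ * (ℓ (k * δ ^ 2))⁻¹ * ℓ k = 1 :=
          hk ▸ hloz (QuotientGroup.mk g)
        rw [mul_eq_one_iff_eq_inv, mul_inv_eq_iff_eq_mul, mul_inv_eq_iff_eq_mul, mul_assoc (ℓ k)⁻¹,
          eq_inv_mul_iff_mul_eq] at h
        exact h
    obtain ⟨u, hσ, hδ⟩ := exists_eq_mul htri' hloz'
    refine ⟨fun v => u (Quotient.out v), fun (g : G) => ?_⟩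
    exact (eq_mk_out hδ (g * σ₁)).trans ((hσ g).trans (congrArg (· * _) (eq_mk_out hδ g).symm))

end Brady

/-! ### The action of the braid group on the edges of the surface -/

namespace HamiltonianSurface

instance : DecidableEq Letter := fun k l => by
  cases k <;> cases l <;> first | exact .isTrue rfl | exact .isFalse nofun

instance : DecidableEq Index := fun k l => by
  cases k <;> cases l <;> first | exact .isTrue rfl | exact .isFalse nofun

instance : Fintype Letter := ⟨{.x, .y, .z}, by rintro ⟨⟩ <;> decide⟩

instance : Fintype Index := ⟨{.a, .b, .c, .d}, by rintro ⟨⟩ <;> decide⟩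

/-- The action of `σ₁` and of `σ₃` on the edges of the surface. -/
def actσ₁ : Edge → Edge
  | (.x, .a) => (.x, .b) | (.x, .b) => (.x, .a) | (.x, .c) => (.x, .d) | (.x, .d) => (.x, .c)
  | (.y, .a) => (.y, .c) | (.y, .c) => (.y, .a) | (.y, .b) => (.y, .d) | (.y, .d) => (.y, .b)
  | (.z, .a) => (.z, .c) | (.z, .c) => (.z, .d) | (.z, .d) => (.z, .b) | (.z, .b) => (.z, .a)

/-- The action of `σ₂` on the edges of the surface. -/
def actσ₂ : Edge → Edge
  | (.x, .a) => (.y, .c) | (.x, .d) => (.y, .b) | (.x, .b) => (.z, .d) | (.x, .c) => (.z, .a)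
  | (.y, .a) => (.z, .b) | (.y, .d) => (.z, .c) | (.y, .b) => (.x, .a) | (.y, .c) => (.x, .d)
  | (.z, .a) => (.x, .c) | (.z, .d) => (.x, .b) | (.z, .b) => (.y, .a) | (.z, .c) => (.y, .d)

/-- The action of `δ` on the edges of the surface. -/
def actδ (e : Edge) : Edge := actσ₁ (actσ₂ (actσ₁ e))

/-- The permutation of the edges by `σ₁` and `σ₃`. -/
def permσ₁ : Equiv.Perm Edge where
  toFun := actσ₁
  invFun e := actσ₁ (actσ₁ (actσ₁ e))
  left_inv := by unfold Function.LeftInverse; decide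
  right_inv := by unfold Function.RightInverse Function.LeftInverse; decide

/-- The permutation of the edges by `σ₂`. -/
def permσ₂ : Equiv.Perm Edge where
  toFun := actσ₂
  invFun e := actσ₂ (actσ₂ (actσ₂ e))
  left_inv := by unfold Function.LeftInverse; decide
  right_inv := by unfold Function.RightInverse Function.LeftInverse; decide

/-- Whether the orientation of an edge of `V` differs from that of the edges of the Brady complex
above it. -/
def flip : Edge → Bool
  | (_, .a) => false | (_, .b) => true | (_, .c) => true | (_, .d) => false

/-- The vertex of `V` below the initial vertices of the edges of the Brady complex above `e`. -/
def origin (e : Edge) : Fin 3 := bif flip e then tgt e else src e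

/-- The number of a letter. -/
def Letter.num : Letter → Fin 3
  | .x => 0 | .y => 1 | .z => 2

/-- The lozenge of `V` below the lozenge of the Brady complex with obtuse corner at the initial
vertex of an edge above `e`. -/
def lozOf : Edge → Letter ⊕ Letter
  | (l, .a) => .inr l | (l, .b) => .inl l | (l, .c) => .inl l | (l, .d) => .inr l

/-- Whether the lozenge of `V` is turned with respect to the lozenge of the Brady complex. -/
def lozHalf : Edge → Bool
  | (_, .a) => false | (_, .d) => true
  | (.y, .b) => false | (_, .b) => true | (.y, .c) => true | (_, .c) => false

/-- Whether the lozenge of `V` is reflected with respect to the lozenge of the Brady complex. -/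
def lozRefl : Edge → Bool
  | (_, .a) => false | (_, .d) => true
  | (.y, .b) => true | (_, .b) => false | (.y, .c) => false | (_, .c) => true

/-- The index of the side of the lozenge of `V` below the side `i` of the lozenge of the Brady
complex. -/
def lozSideIndex (e : Edge) (i : Fin 4) : Fin 4 :=
  bif lozRefl e then (bif lozHalf e then 1 else 3) - i else (bif lozHalf e then 2 else 0) + i

/-- The sides of the Brady lozenge of an edge above `e`. -/
def bradyLozSide (e : Edge) : Fin 4 → Edge × Bool :=
  ![(actδ (actδ (actσ₁ e)), true), (actσ₁ e, false), (actδ (actδ e), false), (e, true)]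

/-- The sides of the Brady triangle of an edge above `e`. -/
def bradyTriSide (e : Edge) : Fin 3 → Edge × Bool :=
  ![(e, true), (actδ (actσ₁ e), true), (actδ (actσ₁ (actδ (actσ₁ e))), true)]

theorem origin_actδ : ∀ e, origin (actδ e) = origin e := by decide

theorem origin_actσ₁ : ∀ e, origin (actσ₁ e) = bif flip e then src e else tgt e := by decide

/-- This expresses both ends of an edge of `V` through `origin`, so that lifting edge ends becomes a
question about orbits of `actδ`. -/
theorem start_eq_origin : ∀ e b, (bif b then src e else tgt e) =
    origin (bif flip e ^^ b then e else actσ₁ e) := by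
  decide

/-- The orbits of `δ` are the fibres of `origin`: this provides the lifts of edges at a vertex,
while the freeness in `actδ_iterate_ne` makes them unique. -/
theorem exists_actδ : ∀ e e', origin e = origin e' → ∃ i : Fin 4, actδ^[i] e = e' := by decide

theorem actδ_iterate_ne : ∀ e (i : Fin 4), actδ^[i] e = e → i = 0 := by decide

theorem exists_act : ∀ e, ∃ i j k : Fin 4, actδ^[i] (actσ₁^[j] (actδ^[k] (.x, .a))) = e := by
  decide

theorem index_actτ : ∀ e, (actδ (actσ₁ e)).2 = e.2 := by decide

theorem lozOf_actδ_sq : ∀ e, lozOf (actδ (actδ e)) = lozOf e := by decide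

theorem lozOf_actσ₁_ne : ∀ e, lozOf (actσ₁ e) ≠ lozOf e := by decide

theorem triSide_eq : ∀ e (i : Fin 3),
    triSide e.2 (bif flip e then e.1.num - i else e.1.num + i) =
      ((bradyTriSide e i).1, flip e ^^ (flip (bradyTriSide e i).1 ^^ (bradyTriSide e i).2)) := by
  decide

theorem lozSide_eq : ∀ e (i : Fin 4), Sum.elim lozSide fillSide (lozOf e) (lozSideIndex e i) =
      ((bradyLozSide e i).1, lozRefl e ^^ (flip (bradyLozSide e i).1 ^^ (bradyLozSide e i).2)) := by
  decide

theorem triSide_injective : ∀ k i k' i', (triSide k i).1 = (triSide k' i').1 → k = k' ∧ i = i' := by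
  decide

theorem lozSide_injective : ∀ l i i', (Sum.elim lozSide fillSide l i).1 =
    (Sum.elim lozSide fillSide l i').1 → i = i' := by
  decide

/-- Only two lozenges of `V` contain a given edge. They are the images of the two lozenges of `X`
along an edge above it, distinct by `lozOf_actσ₁_ne`. -/
theorem eq_lozOf : ∀ l i e, (Sum.elim lozSide fillSide l i).1 = actσ₁ e →
    l = lozOf (actσ₁ e) ∨ l = lozOf e := by
  decide

theorem lozOf_surjective : ∀ l, ∃ e, lozOf e = l := by decide

theorem origin_surjective : ∀ v, ∃ e, origin e = v := by decide

end HamiltonianSurface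

/-! ### The covering of `V` by the Brady complex -/

namespace Brady

open LozengeComplex HamiltonianSurface

/-- The action of the braid group on the edges of the surface. -/
def edgeAction : G →* (Equiv.Perm HamiltonianSurface.Edge)ᵐᵒᵖ :=
  -- `σ₃` acts by the same permutation as `σ₁`, and the opposite group encodes a right action. The
  -- relations are checked on the twelve edges.
  representation ![.op permσ₁, .op permσ₂, .op permσ₁]
    (MulOpposite.unop_injective <| Equiv.ext <| by decide)
    (MulOpposite.unop_injective <| Equiv.ext <| by decide)
    (MulOpposite.unop_injective <| Equiv.ext <| by decide)
    (MulOpposite.unop_injective <| Equiv.ext <| by decide)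

/-- The edge of `V` below an edge of the Brady complex. -/
def edgeMap (g : G) : HamiltonianSurface.Edge := (edgeAction g).unop (.x, .a)

theorem edgeMap_mul_σ₁ (g : G) : edgeMap (g * σ₁) = actσ₁ (edgeMap g) := by
  rw [edgeMap, map_mul, edgeAction, representation_σ₁]
  rfl

theorem edgeMap_mul_σ₃ (g : G) : edgeMap (g * σ₃) = actσ₁ (edgeMap g) := by
  rw [edgeMap, map_mul, edgeAction, representation_σ₃]
  rfl

theorem edgeMap_mul_δ (g : G) : edgeMap (g * δ) = actδ (edgeMap g) := by
  rw [edgeMap, map_mul, edgeAction, representation_δ]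
  rfl

theorem edgeMap_mul_δ_sq (g : G) : edgeMap (g * δ ^ 2) = actδ (actδ (edgeMap g)) := by
  rw [pow_two, ← mul_assoc, edgeMap_mul_δ, edgeMap_mul_δ]

theorem edgeMap_mul_δ_pow (g : G) (n : ℕ) : edgeMap (g * δ ^ n) = actδ^[n] (edgeMap g) := by
  induction n with
  | zero => rw [pow_zero, mul_one]; rfl
  | succ n ih => rw [pow_succ, ← mul_assoc, edgeMap_mul_δ, ih, Function.iterate_succ_apply']

theorem edgeMap_mul_σ₁_pow (g : G) (n : ℕ) : edgeMap (g * σ₁ ^ n) = actσ₁^[n] (edgeMap g) := by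
  induction n with
  | zero => rw [pow_zero, mul_one]; rfl
  | succ n ih => rw [pow_succ, ← mul_assoc, edgeMap_mul_σ₁, ih, Function.iterate_succ_apply']

theorem edgeMap_surjective : Function.Surjective edgeMap := by
  intro e
  obtain ⟨i, j, k, h⟩ := exists_act e
  refine ⟨1 * δ ^ (k : ℕ) * σ₁ ^ (j : ℕ) * δ ^ (i : ℕ), ?_⟩
  rw [edgeMap_mul_δ_pow, edgeMap_mul_σ₁_pow, edgeMap_mul_δ_pow, edgeMap, map_one]
  exact h

theorem mk_mul_delta_pow (g : G) (n : ℕ) :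
    (QuotientGroup.mk (g * δ ^ n) : Vert) = QuotientGroup.mk g :=
  QuotientGroup.mk_mul_of_mem g (Subgroup.npow_mem_zpowers δ n)

theorem exists_eq_mul_delta_pow {g h : G} (hgh : (QuotientGroup.mk g : Vert) = QuotientGroup.mk h) :
    ∃ i : Fin 4, h = g * δ ^ (i : ℕ) := by
  obtain ⟨n, hn⟩ := Subgroup.mem_zpowers_iff.1 (QuotientGroup.eq.1 hgh)
  refine ⟨⟨(n % 4).toNat, by omega⟩, ?_⟩
  have h1 : δ ^ (n % 4).toNat = δ ^ n := by
    rw [← zpow_natCast, Int.toNat_of_nonneg (by omega)]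
    conv_rhs => rw [← Int.emod_add_mul_ediv n 4, zpow_add, zpow_mul]
    rw [show (4 : ℤ) = (4 : ℕ) from rfl, zpow_natCast δ 4, delta_pow_four, one_zpow, mul_one]
  change h = g * δ ^ (n % 4).toNat
  rw [h1, hn, mul_inv_cancel_left]

/-- An edge of the Brady complex is determined by its initial vertex and its image. -/
theorem eq_of_mk_eq {g h : G} (hgh : (QuotientGroup.mk g : Vert) = QuotientGroup.mk h)
    (he : edgeMap g = edgeMap h) : g = h := by
  obtain ⟨i, rfl⟩ := exists_eq_mul_delta_pow hgh
  rw [edgeMap_mul_δ_pow] at he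
  rw [actδ_iterate_ne _ _ he.symm]
  simp

/-- The vertex of `V` below a vertex of the Brady complex. -/
noncomputable def vertMap (v : Vert) : Fin 3 := origin (edgeMap v.out)

theorem vertMap_mk (g : G) : vertMap (QuotientGroup.mk g) = origin (edgeMap g) :=
  eq_mk_out (u := fun g => origin (edgeMap g))
    (fun g => (congrArg origin (edgeMap_mul_δ g)).trans (origin_actδ _)) g

theorem bradyTriSide_edgeMap (t : bradyComplex.Tri) (i : Fin 3) :
    bradyTriSide (edgeMap (Quotient.out t)) i =
      (edgeMap (bradyComplex.triSide t i).1, (bradyComplex.triSide t i).2) := by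
  have h (g : G) : edgeMap (g * (σ₁ * δ)) = actδ (actσ₁ (edgeMap g)) := by
    rw [← mul_assoc, edgeMap_mul_δ, edgeMap_mul_σ₁]
  fin_cases i
  · rfl
  · exact congrArg (·, true) (h _).symm
  · exact congrArg (·, true) ((h _).trans (congrArg (fun e => actδ (actσ₁ e)) (h _))).symm

theorem bradyLozSide_edgeMap (l : bradyComplex.Loz) (i : Fin 4) :
    bradyLozSide (edgeMap (Quotient.out l)) i =
      (edgeMap (bradyComplex.lozSide l i).1, (bradyComplex.lozSide l i).2) := by
  fin_cases i
  · exact congrArg (·, true) ((edgeMap_mul_δ_sq _).trans (by rw [edgeMap_mul_σ₁])).symm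
  · exact congrArg (·, false) (edgeMap_mul_σ₃ _).symm
  · exact congrArg (·, false) (edgeMap_mul_δ_sq _).symm
  · rfl

theorem lozSym_side (e : HamiltonianSurface.Edge) (i : Fin 4) :
    (lozSym (lozHalf e) (lozRefl e)).side i = lozSideIndex e i := by
  rw [lozSideIndex]
  cases lozRefl e <;> rfl

/-- The covering of `V` by the Brady complex. -/
noncomputable def covering : Hom bradyComplex complexV where
  vert := vertMap
  edge := edgeMap
  flip g := HamiltonianSurface.flip (edgeMap g)
  start_edge := by
    rintro ⟨(g : G), _ | _⟩
    · refine Eq.trans ?_ (vertMap_mk (g * σ₁)).symm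
      rw [edgeMap_mul_σ₁, origin_actσ₁, Bool.xor_false]
      rfl
    · refine Eq.trans ?_ (vertMap_mk g).symm
      rw [Bool.xor_true, origin]
      cases h : HamiltonianSurface.flip (edgeMap g) <;> rfl
  tri :=
    { map := fun t => (edgeMap (Quotient.out t)).2
      -- Side `0` of the Brady triangle goes to the side named by the letter of its image; the
      -- boundary is then followed forwards or backwards according to the orientation of that edge.
      sym := fun t => triSym (edgeMap (Quotient.out t)).1.num
        (HamiltonianSurface.flip (edgeMap (Quotient.out t)))
      side_map := fun t i => by
        refine (triSide_eq _ i).trans ?_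
        rw [bradyTriSide_edgeMap]
        rfl }
  loz :=
    { map := fun l => lozOf (edgeMap (Quotient.out l))
      sym := fun l => lozSym (lozHalf (edgeMap (Quotient.out l)))
        (lozRefl (edgeMap (Quotient.out l)))
      side_map := fun l i => by
        rw [lozSym_side]
        refine (lozSide_eq _ i).trans ?_
        rw [bradyLozSide_edgeMap]
        rfl }

theorem covering_tri_map_mk (g : G) :
    covering.tri.map (QuotientGroup.mk g : G ⧸ Subgroup.zpowers (σ₁ * δ)) = (edgeMap g).2 := by
  refine eq_mk_out (u := fun g => (edgeMap g).2) (fun g => ?_) g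
  simp only [← mul_assoc, edgeMap_mul_δ, edgeMap_mul_σ₁, index_actτ]

theorem covering_loz_map_mk (g : G) :
    covering.loz.map (QuotientGroup.mk g : G ⧸ Subgroup.zpowers (δ ^ 2)) = lozOf (edgeMap g) := by
  refine eq_mk_out (u := fun g => lozOf (edgeMap g)) (fun g => ?_) g
  simp only [edgeMap_mul_δ_sq, lozOf_actδ_sq]

theorem mk_triSide (t : bradyComplex.Tri) (i : Fin 3) :
    (QuotientGroup.mk (bradyComplex.triSide t i).1 : G ⧸ Subgroup.zpowers (σ₁ * δ)) = t := by
  have h (g : G) : (QuotientGroup.mk (g * (σ₁ * δ)) : G ⧸ Subgroup.zpowers (σ₁ * δ)) =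
      QuotientGroup.mk g := QuotientGroup.mk_mul_of_mem g (Subgroup.mem_zpowers _)
  have h0 : (QuotientGroup.mk (Quotient.out t : G) : G ⧸ Subgroup.zpowers (σ₁ * δ)) = t :=
    Quotient.out_eq' t
  fin_cases i
  · exact h0
  · exact (h _).trans h0
  · exact (h _).trans ((h _).trans h0)

theorem exists_triSide_eq (g : G) : ∃ i,
    (bradyComplex.triSide (QuotientGroup.mk g : G ⧸ Subgroup.zpowers (σ₁ * δ)) i).1 = g := by
  have h := (eq_mk_out_iff (d := σ₁ * δ)
    (u := fun k => k = g ∨ k * (σ₁ * δ) = g ∨ k * (σ₁ * δ) * (σ₁ * δ) = g) (fun k => ?_) g).2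
        (.inl rfl)
  · obtain h | h | h := h
    exacts [⟨0, h⟩, ⟨1, h⟩, ⟨2, h⟩]
  · have h3 : k * (σ₁ * δ) * (σ₁ * δ) * (σ₁ * δ) = k := by
      rw [mul_assoc k, mul_assoc k, σ₁_mul_delta_pow_three, mul_one]
    rw [h3]
    tauto

theorem exists_lozSide_eq (g : G) : ∃ i,
    (bradyComplex.lozSide (QuotientGroup.mk g : G ⧸ Subgroup.zpowers (δ ^ 2)) i).1 = g := by
  have h := (eq_mk_out_iff (d := δ ^ 2)
    (u := fun k => k = g ∨ k * δ ^ 2 = g) (fun k => ?_) g).2 (.inl rfl)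
  · obtain h | h := h
    exacts [⟨3, h⟩, ⟨2, h⟩]
  · rw [mul_assoc, delta_sq_mul_delta_sq, mul_one, or_comm]

theorem exists_lozSide_eq_mul_σ₃ (g : G) : ∃ i,
    (bradyComplex.lozSide (QuotientGroup.mk g : G ⧸ Subgroup.zpowers (δ ^ 2)) i).1 = g * σ₃ := by
  have h := (eq_mk_out_iff (d := δ ^ 2)
    (u := fun k => k * σ₃ = g * σ₃ ∨ k * σ₁ * δ ^ 2 = g * σ₃) (fun k => ?_) g).2 (.inl rfl)
  · obtain h | h := h
    exacts [⟨1, h⟩, ⟨0, h⟩]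
  · rw [mul_assoc k, delta_sq_mul_σ₃, ← mul_assoc, mul_assoc k (δ ^ 2), delta_sq_mul_σ₁,
      ← mul_assoc, mul_assoc (k * σ₃), delta_sq_mul_delta_sq, mul_one, or_comm]

/-- The two lozenges at an edge of the Brady complex. -/
theorem mk_lozSide (l : bradyComplex.Loz) (i : Fin 4) :
    ∃ g : G, (QuotientGroup.mk g : G ⧸ Subgroup.zpowers (δ ^ 2)) = l ∧
      ((bradyComplex.lozSide l i).1 = g ∨ (bradyComplex.lozSide l i).1 = g * σ₃) := by
  have h0 : (QuotientGroup.mk (Quotient.out l : G) : G ⧸ Subgroup.zpowers (δ ^ 2)) = l :=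
    Quotient.out_eq' l
  have h1 : (QuotientGroup.mk (Quotient.out l * δ ^ 2 : G) : G ⧸ Subgroup.zpowers (δ ^ 2)) = l :=
    (QuotientGroup.mk_mul_of_mem _ (Subgroup.mem_zpowers _)).trans h0
  fin_cases i
  · refine ⟨_, h1, .inr ?_⟩
    have (k : G) : k * σ₁ * δ ^ 2 = k * δ ^ 2 * σ₃ := by
      rw [mul_assoc, mul_assoc, delta_sq_mul_σ₃]
    exact this _
  · exact ⟨_, h0, .inr rfl⟩
  · exact ⟨_, h1, .inl rfl⟩
  · exact ⟨_, h0, .inl rfl⟩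

/-- The edges leaving `[g]` are the `g δ^i`, and those arriving there are the `g δ^i σ₁⁻¹`. Both
kinds are governed by the free and transitive action of `δ` on the edges of `V` with a given origin.
-/
theorem isCovering_edgeMap : covering.toEdgeMap.IsCovering where
  lift := by
    intro v (e : HamiltonianSurface.Edge) b h
    obtain ⟨g, rfl⟩ := QuotientGroup.mk_surjective v
    have h1 : origin (edgeMap g) =
        origin (bif HamiltonianSurface.flip e ^^ b then e else actσ₁ e) :=
      (h.trans (vertMap_mk g)).symm.trans (start_eq_origin e b)
    obtain ⟨i, hi⟩ := exists_actδ _ _ h1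
    rw [← edgeMap_mul_δ_pow] at hi
    cases hb : HamiltonianSurface.flip e ^^ b <;> rw [hb] at hi
    · have h2 : edgeMap (g * δ ^ (i : ℕ) * σ₁⁻¹) = e := by
        apply permσ₁.injective
        change actσ₁ _ = actσ₁ _
        rw [← edgeMap_mul_σ₁, inv_mul_cancel_right]
        exact hi
      have h3 : (HamiltonianSurface.flip (edgeMap (g * δ ^ (i : ℕ) * σ₁⁻¹)) ^^ b) = false := by
        rw [h2, hb]
      refine ⟨(g * δ ^ (i : ℕ) * σ₁⁻¹ : G), h2, (congrArg (fun c => bradyComplex.start (_, c))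
          h3).trans ?_⟩
      change (QuotientGroup.mk (g * δ ^ (i : ℕ) * σ₁⁻¹ * σ₁) : Vert) = _
      rw [inv_mul_cancel_right, mk_mul_delta_pow]
    · have h3 : (HamiltonianSurface.flip (edgeMap (g * δ ^ (i : ℕ))) ^^ b) = true := by
        rw [hi, cond_true, hb]
      exact ⟨(g * δ ^ (i : ℕ) : G), hi, (congrArg (fun c => bradyComplex.start (_, c)) h3).trans
        (mk_mul_delta_pow _ _)⟩
  unique := by
    intro (g : G) (h : G) b he hv
    have hf : covering.flip g = covering.flip h := congrArg HamiltonianSurface.flip he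
    rw [← hf] at hv
    cases hb : covering.flip g ^^ b <;> rw [hb] at hv
    · refine mul_right_cancel (G := G) (b := σ₁) (eq_of_mk_eq hv ?_)
      rw [edgeMap_mul_σ₁, edgeMap_mul_σ₁]
      exact congrArg actσ₁ he
    · exact eq_of_mk_eq hv he

/-- In `X` the edge `g` lies only on the triangle `g⟨σ₁δ⟩`, and in `V` each edge is a side of
exactly one triangle. -/
theorem isCovering_tri : covering.tri.IsCovering where
  lift := by
    intro (g : G) t' j h
    obtain ⟨i, hi⟩ := exists_triSide_eq g
    have h1 := covering.tri.side_map (QuotientGroup.mk g : G ⧸ Subgroup.zpowers (σ₁ * δ)) i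
    rw [hi] at h1
    have h2 := triSide_injective _ _ _ _ ((congrArg Prod.fst h1).trans h.symm)
    exact ⟨_, i, h2.1, h2.2, hi⟩
  unique t₁ i₁ t₂ i₂ _ _ h := by
    rw [← mk_triSide t₁ i₁, h, mk_triSide]

theorem isCovering_loz : covering.loz.IsCovering where
  lift := by
    intro (g : G) t' j h
    have key : ∃ (l : bradyComplex.Loz) (i : Fin 4), covering.loz.map l = t' ∧
        (bradyComplex.lozSide l i).1 = g := by
      have hg : edgeMap g = actσ₁ (edgeMap (g * σ₃⁻¹)) := by
        rw [← edgeMap_mul_σ₃, inv_mul_cancel_right]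
      -- The two lozenges at the edge `g` are the cosets of `g` and of `g σ₃⁻¹`; which one lies
      -- above `t'` is decided by `eq_lozOf`.
      obtain h1 | h1 := eq_lozOf t' j _ (h.trans hg)
      · obtain ⟨i, hi⟩ := exists_lozSide_eq g
        exact ⟨_, i, by rw [h1, covering_loz_map_mk, hg], hi⟩
      · obtain ⟨i, hi⟩ := exists_lozSide_eq_mul_σ₃ (g * σ₃⁻¹)
        exact ⟨_, i, by rw [h1, covering_loz_map_mk], hi.trans (inv_mul_cancel_right g σ₃)⟩
    obtain ⟨l, i, hl, hi⟩ := key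
    refine ⟨l, i, hl, ?_, hi⟩
    have h1 := covering.loz.side_map l i
    rw [hi, hl] at h1
    exact lozSide_injective _ _ _ ((congrArg Prod.fst h1).trans h.symm)
  unique l₁ i₁ l₂ i₂ hl _ h := by
    obtain ⟨g₁, rfl, h1⟩ := mk_lozSide l₁ i₁
    obtain ⟨g₂, rfl, h2⟩ := mk_lozSide l₂ i₂
    rw [covering_loz_map_mk, covering_loz_map_mk] at hl
    rw [h] at h1
    -- If the common edge sits in different positions, the representatives differ by `σ₃`, and then
    -- the two images would be different lozenges.
    obtain h1 | h1 := h1 <;> obtain h2 | h2 := h2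
    · rw [← h1, h2]
    · rw [← h1, h2, edgeMap_mul_σ₃] at hl
      exact absurd hl (lozOf_actσ₁_ne _)
    · rw [← h2, h1, edgeMap_mul_σ₃] at hl
      exact absurd hl.symm (lozOf_actσ₁_ne _)
    · rw [mul_right_cancel (G := G) (h1.symm.trans h2)]

theorem isCovering_covering : covering.IsCovering where
  edge := isCovering_edgeMap
  tri := isCovering_tri
  loz := isCovering_loz
  vert_surjective v := by
    obtain ⟨e, he⟩ := origin_surjective v
    obtain ⟨g, rfl⟩ := edgeMap_surjective e
    exact ⟨_, (vertMap_mk g).trans he⟩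
  tri_surjective k := by
    obtain ⟨g, hg⟩ := edgeMap_surjective (.x, k)
    exact ⟨_, (covering_tri_map_mk g).trans (congrArg Prod.snd hg)⟩
  loz_surjective l := by
    obtain ⟨e, he⟩ := lozOf_surjective l
    obtain ⟨g, rfl⟩ := edgeMap_surjective e
    exact ⟨_, (covering_loz_map_mk g).trans he⟩
  edge_surjective := edgeMap_surjective

end Brady

theorem mainTheorem4 :
    ∃ p : Brady.bradyComplex.Realization → HamiltonianSurface.complexV.Realization,
      IsUniversalCover p ∧ LozengeComplex.IsCellwiseIsometric p := by
  have : Nonempty Brady.bradyComplex.Vert := ⟨(QuotientGroup.mk 1 : Brady.Vert)⟩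
  exact ⟨Brady.covering.realization,
    ⟨Brady.isCovering_covering.isCoveringMap_realization,
      Brady.isCovering_covering.surjective_realization, Brady.simplyConnectedSpace_bradyComplex⟩,
    Brady.covering.isCellwiseIsometric_realization⟩
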